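/- **Setting.** Let $N\ge 2$, $m\ge 1$, and let $r_0=r_N=1$ and $r_1,\dots,r_{N-1}\ge 1$ be integers, $\overline r=\max_{1\le i\le N-1}r_i$. For factors $X_i=(X_i(s_i))_{s_i=1}^{d_i}$ with slices $X_i(s_i)\in\mathbb R^{r_{i-1}\times r_i}$, let $[X_1,\dots,X_N]\in\mathbb R^{d_1\times\cdots\times d_N}$ be the tensor (TT format) with entries $X_1(s_1)X_2(s_2)\cdots X_N(s_N)$, and let $L(X_i)\in\mathbb R^{d_ir_{i-1}\times r_i}$ be the left unfolding, i.e. the matrix of the slices $X_i(1),\dots,X_i(d_i)$ stacked vertically. The factors are left-orthogonal if $L(X_i)^\top L(X_i)=I_{r_i}$ for all $i\le N-1$. For a tensor $\mathcal X$, $\mathcal X^{\langle i\rangle}\in\mathbb R^{(d_1\cdots d_i)\times(d_{i+1}\cdots d_N)}$ denotes its $i$-th unfolding; its TT ranks are $\operatorname{rank}\mathcal X^{\langle i\rangle}$, $1\le i\le N-1$. Let $\mathcal X^\star=[X_1^\star,\dots,X_N^\star]$ have TT ranks $r_1,\dots,r_{N-1}$ and left-orthogonal factors, and put $$\overline\sigma=\max_{1\le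 i\le N-1}\sigma_1(\mathcal X^{\star\langle i\rangle}),\qquad \underline\sigma=\min_{1\le i\le N-1}\sigma_{r_i}(\mathcal X^{\star\langle i\rangle}),\qquad \kappa(\mathcal X^\star)=\overline\sigma/\underline\sigma .$$ Let $\mathcal A(\mathcal X)=(\langle\mathcal A_k,\mathcal X\rangle)_{k=1}^m$ be a linear map, $y=\mathcal A(\mathcal X^\star)+s$ with $s\in\mathbb R^m$, let $p_s$ be the fraction of nonzero entries of $s$, and $F(X_1,\dots,X_N)=\frac1m\|\mathcal A([X_1,\dots,X_N])-y\|_1$. **Assumptions.** Let $\delta=\delta_{(N+1)\overline r}\le(1-2p_s)\sqrt{2/\pi}$ be such that * ($\ell_1/\ell_2$-RIP) $(\sqrt{2/\pi}-\delta)\|\mathcal X\|_F\le\frac1m\|\mathcal A(\mathcal X)\|_1\le(\sqrt{2/\pi}+\delta)\|\mathcal X\|_F$ for all tensors $\mathcal X$ whose TT ranks are all at most $(N+1)\overline r$; * (sharpness) $\frac1m\|\mathcal A(\mathcal X-\mathcal X^\star)-s\|_1-\frac1m\|s\|_1\ge((1-2p_s)\sqrt{2/\pi}-\delta)\|\mathcal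 X-\mathcal X^\star\|_F$ for all tensors $\mathcal X$ with TT ranks $(r_1,\dots,r_{N-1})$. **Distance and subgradients.** For orthogonal $R_i\in\mathbb R^{r_i\times r_i}$ with $R_0=R_N=1$, let $L_R(X_i^\star)$ be the left unfolding of the factor with slices $R_{i-1}^\top X_i^\star(s_i)R_i$, and let $$\operatorname{dist}^2(\{X_i\},\{X_i^\star\})=\min_{R_1,\dots,R_{N-1}}\ \sum_{i=1}^{N-1}\overline\sigma^2\|L(X_i)-L_R(X_i^\star)\|_F^2+\|L(X_N)-L_R(X_N^\star)\|_2^2 .$$ Let $\partial_{L(X_i)}F$ be the left unfolding of the factor with slices $$\partial_{X_i(s_i)}F=\frac1m\sum_{k=1}^m\operatorname{sign}(\langle\mathcal A_k,[X_1,\dots,X_N]\rangle-y_k)\sum_{s_j,\,j\ne i}\mathcal A_k(s_1,\dots,s_N)\,X_{i-1}^\top(s_{i-1})\cdots X_1^\top(s_1)\,X_N^\top(s_N)\cdots X_{i+1}^\top(s_{i+1}),$$ where $\operatorname{sign}(0)=0$. For $i\le N-1$ let $\mathcal P_i(U)=U-\frac12L(X_i)\big(U^\top L(X_i)+L(X_i)^\top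 U\big)$ be the projection onto the tangent space of the Stiefel manifold at $L(X_i)$, and let $\mathcal P_N$ be the identity. **Claim.** Let $$b=\frac{\underline\sigma^4\,((1-2p_s)\sqrt{2/\pi}-\delta)^2}{144\,(2N^2-2N+1)\,(N+1+\sum_{i=2}^{N-1}r_i)^2\,(\sqrt{2/\pi}+\delta)^2\,\overline\sigma^2}.$$ Then for every $\mathcal X=[X_1,\dots,X_N]$ with left-orthogonal factors, $X_i(s_i)\in\mathbb R^{r_{i-1}\times r_i}$, and $\|\mathcal X-\mathcal X^\star\|_F^2\le b$, and for all $R_1,\dots,R_{N-1}$ that attain the minimum in $\operatorname{dist}^2(\{X_i\},\{X_i^\star\})$, $$\sum_{i=1}^N\Big\langle L(X_i)-L_R(X_i^\star),\ \mathcal P_i\big(\partial_{L(X_i)}F(X_1,\dots,X_N)\big)\Big\rangle\ \ge\ \frac{(1-2p_s)\sqrt{2/\pi}-\delta}{4\sqrt{2\,(N+1+\sum_{i=2}^{N-1}r_i)}\;\kappa(\mathcal X^\star)}\ \operatorname{dist}(\{X_i\},\{X_i^\star\}).$$ -/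

import Mathlib

open Matrix
open scoped BigOperators

noncomputable section

namespace TTRecovery

/-- Real tensors of order `N` and size `d 0 × ⋯ × d (N-1)`. The Euclidean norm `‖X‖` is the
Frobenius norm and `inner ℝ A X` is the sum of the products of the entries. -/
abbrev Tensor {N : ℕ} (d : Fin N → ℕ) : Type :=
  EuclideanSpace ℝ ((i : Fin N) → Fin (d i))

/-- The interior bonds `1, …, N - 1`. -/
abbrev Bond (N : ℕ) : Type := {k : Fin (N + 1) // 0 < (k : ℕ) ∧ (k : ℕ) < N}

/-- The `k`-th unfolding: rows are indexed by the first `k` indices, columns by the others. -/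
def unfolding {N : ℕ} {d : Fin N → ℕ} (X : Tensor d) (k : Bond N) :
    Matrix ((i : {i : Fin N // (i : ℕ) < (k.1 : ℕ)}) → Fin (d i))
      ((i : {i : Fin N // ¬ (i : ℕ) < (k.1 : ℕ)}) → Fin (d i)) ℝ :=
  Matrix.of fun a b =>
    X ((Equiv.piEquivPiSubtypeProd (fun i : Fin N => (i : ℕ) < (k.1 : ℕ))
      (fun i => Fin (d i))).symm (a, b))

/-- The TT ranks of a tensor, as the ranks of its unfoldings. -/
def ttRank {N : ℕ} {d : Fin N → ℕ} (X : Tensor d) (k : Bond N) : ℕ := (unfolding X k).rank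

/-- The `j`-th largest singular value of the `k`-th unfolding, counted from `j = 1`
(Mathlib counts singular values from zero). -/
def sv {N : ℕ} {d : Fin N → ℕ} (X : Tensor d) (k : Bond N) (j : ℕ) : ℝ :=
  (Matrix.toEuclideanLin (unfolding X k)).singularValues (j - 1)

/-- The largest singular value `max_k σ₁` of all unfoldings. -/
def sigmaMax {N : ℕ} {d : Fin N → ℕ} (X : Tensor d) : ℝ := ⨆ k : Bond N, sv X k 1

/-- The smallest singular value `min_k σ_{r_k}`, where `r_k` is the `k`-th TT rank. -/
def sigmaMin {N : ℕ} {d : Fin N → ℕ} (X : Tensor d) : ℝ := ⨅ k : Bond N, sv X k (ttRank X k)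

/-- The condition number. -/
def kappa {N : ℕ} {d : Fin N → ℕ} (X : Tensor d) : ℝ := sigmaMax X / sigmaMin X

/-- TT factors: `X i s` is the slice `X_i(s)`, of size `r_{i-1} × r_i`. The sizes `r` are indexed
by `0, …, N`; factor `i` sits between the sizes `r i.castSucc` and `r i.succ`. -/
abbrev Factors {N : ℕ} (d : Fin N → ℕ) (r : Fin (N + 1) → ℕ) : Type :=
  (i : Fin N) → Fin (d i) → Matrix (Fin (r i.castSucc)) (Fin (r i.succ)) ℝ

/-- The product of the first `k` slices. -/
def leftProd {N : ℕ} {d : Fin N → ℕ} {r : Fin (N + 1) → ℕ} (X : Factors d r)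
    (s : (i : Fin N) → Fin (d i)) (k : Fin (N + 1)) : Matrix (Fin (r 0)) (Fin (r k)) ℝ :=
  Fin.induction (motive := fun k => Matrix (Fin (r 0)) (Fin (r k)) ℝ)
    1 (fun i P => P * X i (s i)) k

/-- The product of the slices after the first `k`. -/
def rightProd {N : ℕ} {d : Fin N → ℕ} {r : Fin (N + 1) → ℕ} (X : Factors d r)
    (s : (i : Fin N) → Fin (d i)) (k : Fin (N + 1)) :
    Matrix (Fin (r k)) (Fin (r (Fin.last N))) ℝ :=
  Fin.reverseInduction (motive := fun k => Matrix (Fin (r k)) (Fin (r (Fin.last N))) ℝ)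
    1 (fun i Q => X i (s i) * Q) k

/-- The tensor `[X_1, …, X_N]` with entries `X_1(s_1) ⋯ X_N(s_N)`, a `1 × 1` matrix product. -/
def ttTensor {N : ℕ} {d : Fin N → ℕ} {r : Fin (N + 1) → ℕ} (h0 : r 0 = 1)
    (hN : r (Fin.last N) = 1) (X : Factors d r) : Tensor d :=
  WithLp.toLp 2 fun s => leftProd X s (Fin.last N) ⟨0, by omega⟩ ⟨0, by omega⟩

/-- The left unfolding: the slices stacked on top of each other. -/
def leftUnfold {d p q : ℕ} (Y : Fin d → Matrix (Fin p) (Fin q) ℝ) :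
    Matrix (Fin d × Fin p) (Fin q) ℝ :=
  Matrix.of fun a b => Y a.1 a.2 b

/-- Left-orthogonal format: the left unfoldings of all factors but the last have orthonormal
columns. -/
def LeftOrthogonal {N : ℕ} {d : Fin N → ℕ} {r : Fin (N + 1) → ℕ} (X : Factors d r) : Prop :=
  ∀ i : Fin N, (i : ℕ) + 1 < N → (leftUnfold (X i))ᵀ * leftUnfold (X i) = 1

/-- The Frobenius inner product of matrices. -/
def frobInner {m n : Type} [Fintype m] [Fintype n] (A B : Matrix m n ℝ) : ℝ :=
  ∑ a, ∑ b, A a b * B a b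

/-- The squared Frobenius norm of a matrix. -/
def frobSq {m n : Type} [Fintype m] [Fintype n] (A : Matrix m n ℝ) : ℝ := frobInner A A

/-- Families of orthogonal matrices `R_0, …, R_N` with `R_0 = R_N = 1`. -/
def Rotations {N : ℕ} (r : Fin (N + 1) → ℕ) :
    Set ((k : Fin (N + 1)) → Matrix (Fin (r k)) (Fin (r k)) ℝ) :=
  {R | (∀ k, R k ∈ Matrix.orthogonalGroup (Fin (r k)) ℝ) ∧ R 0 = 1 ∧ R (Fin.last N) = 1}

/-- The rotated factors, with slices `R_{i-1}ᵀ X_i(s) R_i`. -/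
def rotate {N : ℕ} {d : Fin N → ℕ} {r : Fin (N + 1) → ℕ}
    (R : (k : Fin (N + 1)) → Matrix (Fin (r k)) (Fin (r k)) ℝ) (X : Factors d r) : Factors d r :=
  fun i s => (R i.castSucc)ᵀ * X i s * R i.succ

/-- The squared weighted distance of the factors `X` to the rotation by `R` of `Y`: the squared
Frobenius distances of the left unfoldings, all but the last multiplied by `w ^ 2`. -/
def rotDistSq {N : ℕ} {d : Fin N → ℕ} {r : Fin (N + 1) → ℕ} (w : ℝ) (X Y : Factors d r)
    (R : (k : Fin (N + 1)) → Matrix (Fin (r k)) (Fin (r k)) ℝ) : ℝ :=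
  ∑ i : Fin N, (if (i : ℕ) + 1 < N then w ^ 2 else 1) *
    frobSq (leftUnfold (X i) - leftUnfold (rotate R Y i))

/-- `R` attains the minimum over all rotations. -/
def IsBestRotation {N : ℕ} {d : Fin N → ℕ} {r : Fin (N + 1) → ℕ} (w : ℝ) (X Y : Factors d r)
    (R : (k : Fin (N + 1)) → Matrix (Fin (r k)) (Fin (r k)) ℝ) : Prop :=
  R ∈ Rotations r ∧ IsMinOn (rotDistSq w X Y) (Rotations r) R

/-- The distance of two families of factors: the square root of the minimum of `rotDistSq` over
all rotations. The minimum is attained, see `exists_isBestRotation`. -/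
def factorDist {N : ℕ} {d : Fin N → ℕ} {r : Fin (N + 1) → ℕ} (w : ℝ) (X Y : Factors d r) : ℝ :=
  Real.sqrt (sInf (rotDistSq w X Y '' Rotations r))

/-- The fraction of nonzero entries (outliers) of `s`. -/
def outlierFraction {m : ℕ} (s : Fin m → ℝ) : ℝ :=
  ((Finset.univ.filter fun k => s k ≠ 0).card : ℝ) / m

/-- The `ℓ₁/ℓ₂` restricted isometry property with constant `δ` for all tensors whose TT ranks
are at most `ρ`; the measurement operator is `X ↦ (⟨A_1, X⟩, …, ⟨A_m, X⟩)`. -/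
def L1L2RIP {N m : ℕ} {d : Fin N → ℕ} (A : Fin m → Tensor d) (ρ : ℕ) (δ : ℝ) : Prop :=
  ∀ X : Tensor d, (∀ k, ttRank X k ≤ ρ) →
    (Real.sqrt (2 / Real.pi) - δ) * ‖X‖ ≤ 1 / (m : ℝ) * ∑ k, |inner ℝ (A k) X| ∧
    1 / (m : ℝ) * ∑ k, |inner ℝ (A k) X| ≤ (Real.sqrt (2 / Real.pi) + δ) * ‖X‖

/-- Sharpness with constant `δ` at `Xstar` under the outlier vector `s`, for all tensors that have
the same TT ranks as `Xstar`. -/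
def Sharpness {N m : ℕ} {d : Fin N → ℕ} (A : Fin m → Tensor d) (Xstar : Tensor d)
    (s : Fin m → ℝ) (δ : ℝ) : Prop :=
  ∀ X : Tensor d, (∀ k, ttRank X k = ttRank Xstar k) →
    ((1 - 2 * outlierFraction s) * Real.sqrt (2 / Real.pi) - δ) * ‖X - Xstar‖ ≤
      1 / (m : ℝ) * ∑ k, |inner ℝ (A k) (X - Xstar) - s k| - 1 / (m : ℝ) * ∑ k, |s k|

/-- The subgradient of `F(X_1, …, X_N) = (1/m) ‖A([X_1, …, X_N]) - y‖₁` in the slice `X_i(t)`: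
`(1/m) ∑_k sign(⟨A_k, [X]⟩ - y_k) ∑_{s, s_i = t} A_k(s) • (X_1(s_1) ⋯ X_{i-1}(s_{i-1}))ᵀ *
(X_{i+1}(s_{i+1}) ⋯ X_N(s_N))ᵀ`, with `sign 0 = 0`. The two matrices in the last product are a
column and a row, so that the product is written out entrywise. -/
def subgrad {N m : ℕ} {d : Fin N → ℕ} {r : Fin (N + 1) → ℕ} (h0 : r 0 = 1)
    (hN : r (Fin.last N) = 1) (A : Fin m → Tensor d) (y : Fin m → ℝ) (X : Factors d r) :
    Factors d r :=
  fun i t => Matrix.of fun a b =>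
    1 / (m : ℝ) * ∑ k, Real.sign (inner ℝ (A k) (ttTensor h0 hN X) - y k) *
      ∑ s ∈ Finset.univ.filter (fun s : (j : Fin N) → Fin (d j) => s i = t),
        A k s * (leftProd X s i.castSucc ⟨0, by omega⟩ a * rightProd X s i.succ b ⟨0, by omega⟩)

/-- The orthogonal projection onto the tangent space of the Stiefel manifold at `L`. -/
def tangentProj {m n : Type} [Fintype m] [Fintype n] (L U : Matrix m n ℝ) : Matrix m n ℝ :=
  U - (1 / 2 : ℝ) • (L * (Uᵀ * L + Lᵀ * U))

/-- The Riemannian subgradient in the left unfolding of factor `i`: the subgradient projected onto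
the tangent space of the Stiefel manifold, and not projected for the last factor. -/
def riemSubgrad {N m : ℕ} {d : Fin N → ℕ} {r : Fin (N + 1) → ℕ} (h0 : r 0 = 1)
    (hN : r (Fin.last N) = 1) (A : Fin m → Tensor d) (y : Fin m → ℝ) (X : Factors d r)
    (i : Fin N) : Matrix (Fin (d i) × Fin (r i.castSucc)) (Fin (r i.succ)) ℝ :=
  if (i : ℕ) + 1 < N then
    tangentProj (leftUnfold (X i)) (leftUnfold (subgrad h0 hN A y X i))
  else leftUnfold (subgrad h0 hN A y X i)

/-- The largest of the interior sizes `r_1, …, r_{N-1}`. -/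
def rMax {N : ℕ} (r : Fin (N + 1) → ℕ) : ℕ := Finset.univ.sup fun k : Bond N => r k.1

/-- The number `N + 1 + ∑_{i=2}^{N-1} r_i`. -/
def rankSum {N : ℕ} (r : Fin (N + 1) → ℕ) : ℝ :=
  (N : ℝ) + 1 + ∑ k ∈ Finset.univ.filter (fun k : Fin (N + 1) => 2 ≤ (k : ℕ) ∧ (k : ℕ) < N),
    (r k : ℝ)

theorem isCompact_rotations {N : ℕ} (r : Fin (N + 1) → ℕ) : IsCompact (Rotations r) := by
  have hsub : Rotations r ⊆ Set.pi Set.univ fun k : Fin (N + 1) =>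
      (Set.pi Set.univ fun _ : Fin (r k) => Set.pi Set.univ fun _ : Fin (r k) =>
        Set.Icc (-1 : ℝ) 1 : Set (Matrix (Fin (r k)) (Fin (r k)) ℝ)) := by
    intro R hR k _ a _ b _
    have h := entry_norm_bound_of_unitary (hR.1 k) a b
    rw [Real.norm_eq_abs] at h
    exact abs_le.mp h
  refine IsCompact.of_isClosed_subset ?_ ?_ hsub
  · exact isCompact_univ_pi fun k => isCompact_univ_pi fun a => isCompact_univ_pi fun b =>
      isCompact_Icc
  · have : Rotations r = (⋂ k, {R | R k * (R k)ᵀ = 1}) ∩ ({R | R 0 = 1} ∩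
        {R | R (Fin.last N) = 1}) := by
      ext R
      simp only [Rotations, Matrix.mem_orthogonalGroup_iff, Set.mem_ofPred_eq, Set.mem_inter_iff,
        Set.mem_iInter]
    rw [this]
    refine (isClosed_iInter fun k => ?_).inter (IsClosed.inter ?_ ?_)
    · exact isClosed_eq (by fun_prop) continuous_const
    · exact isClosed_eq (by fun_prop) continuous_const
    · exact isClosed_eq (by fun_prop) continuous_const

theorem exists_isBestRotation {N : ℕ} {d : Fin N → ℕ} {r : Fin (N + 1) → ℕ} (w : ℝ)
    (X Y : Factors d r) : ∃ R, IsBestRotation w X Y R := by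
  have hne : (Rotations r).Nonempty := ⟨fun _ => 1, fun _ => one_mem _, rfl, rfl⟩
  have hc : ContinuousOn (rotDistSq w X Y) (Rotations r) := by
    apply Continuous.continuousOn
    unfold rotDistSq frobSq frobInner leftUnfold rotate
    simp only [Matrix.sub_apply, Matrix.of_apply, Matrix.mul_apply, Matrix.transpose_apply]
    fun_prop
  obtain ⟨R, hR, hmin⟩ := (isCompact_rotations r).exists_isMinOn hne hc
  exact ⟨R, hR, hmin⟩

end TTRecovery

end

/-! Write `X` for the tensor of `U`, `Xs` for the ground truth, `W` for the optimally rotated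
factors of `Xs`, and put `e = ‖X - Xs‖`, `c = (1 - 2p)√(2/π) - δ`, `K = √(2/π) + δ`, `D` for the
factor distance, `S = rankSum r`, `σ` and `τ` for the extreme singular values of `Xs`.

The tangent projections are self-adjoint, so they move from the subgradients to the differences `U i
- W i`. By multilinearity the left side becomes the mean of `sign(residual) * ⟨A_k, X - Xs + Z⟩`,
where `Z` is the error of replacing `X - Xs` by its projected linearization at `U`
(`sum_frobInner_riemSubgrad`). Sharpness and the subgradient inequality for the absolute value make
the part of `X - Xs` at least `c e`; the upper RIP bound limits the part of `Z` to `K ‖Z‖`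
(`sign_sum_lower_bound`). The RIP applies because the unfoldings of `Z` have at most three times the
ranks of the format (`rank_cut_linearization_le`).

Two estimates then close the argument. The error is quadratic, `‖Z‖ ≤ 3N/(4σ) D²`
(`ttTensor_linearization_le`): the tensor difference telescopes over the factors, partial products
of left-orthogonal factors are isometries, and the normal part removed by a projection is itself
quadratic. Conversely `D² ≤ 8 S (σ/τ)² e²` (`exists_rotations_rotDistSq_le`): a sine-type bound and
Procrustes alignment match the left subspaces at every bond, and the factors are recovered from
consecutive partial products.

The second estimate makes `c e` at least twice the claimed bound, and the radius of the ball makes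
`K ‖Z‖` at most once the claimed bound (`regularity_bound`). The radius also gives `e ≤ τ/12`
(`norm_ball_bound`), so that `X` has the ranks of `Xs` and sharpness applies, and the unfoldings of
`X` have norm at most `3σ/2`. -/

noncomputable section

namespace TTRecovery

/-! ### Frobenius and spectral bounds, isometries, and the tangent projection. -/

section MatrixNorms

variable {l m n o : Type} [Fintype l] [Fintype m] [Fintype n] [Fintype o]

/-- The Euclidean norm of a vector. -/
def vecNorm (v : n → ℝ) : ℝ := ‖WithLp.toLp 2 v‖

/-- The Frobenius norm of a matrix. -/
def frobNorm (M : Matrix m n ℝ) : ℝ := vecNorm fun p : m × n => M p.1 p.2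

/-- The spectral norm of `M` is at most `c`. -/
def OpLe (M : Matrix m n ℝ) (c : ℝ) : Prop := ∀ v, vecNorm (M *ᵥ v) ≤ c * vecNorm v

theorem vecNorm_nonneg (v : n → ℝ) : 0 ≤ vecNorm v := norm_nonneg _

theorem vecNorm_sq (v : n → ℝ) : vecNorm v ^ 2 = v ⬝ᵥ v := by
  simp only [vecNorm, EuclideanSpace.norm_sq_eq, dotProduct, Real.norm_eq_abs, sq_abs]
  simp only [sq]

theorem vecNorm_sq_eq_sum (v : n → ℝ) : vecNorm v ^ 2 = ∑ i, v i ^ 2 := by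
  rw [vecNorm_sq]
  simp only [dotProduct, sq]

theorem vecNorm_add_le (v w : n → ℝ) : vecNorm (v + w) ≤ vecNorm v + vecNorm w := by
  simpa [vecNorm] using norm_add_le (WithLp.toLp 2 v) (WithLp.toLp 2 w)

theorem vecNorm_sub_le (v w : n → ℝ) : vecNorm (v - w) ≤ vecNorm v + vecNorm w := by
  simpa [vecNorm] using norm_sub_le (WithLp.toLp 2 v) (WithLp.toLp 2 w)

theorem vecNorm_smul (c : ℝ) (v : n → ℝ) : vecNorm (c • v) = |c| * vecNorm v := by
  simp [vecNorm, norm_smul]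

theorem abs_dotProduct_le (v w : n → ℝ) : |v ⬝ᵥ w| ≤ vecNorm v * vecNorm w := by
  have h := abs_real_inner_le_norm (WithLp.toLp 2 v) (WithLp.toLp 2 w)
  rw [EuclideanSpace.inner_eq_star_dotProduct, dotProduct_comm] at h
  simpa [vecNorm] using h

theorem vecNorm_eq_zero {v : n → ℝ} (h : vecNorm v = 0) : v = 0 := by
  simpa [vecNorm] using h

theorem vecNorm_comp_equiv (e : m ≃ n) (v : n → ℝ) : vecNorm (v ∘ e) = vecNorm v := by
  rw [← sq_eq_sq₀ (vecNorm_nonneg _) (vecNorm_nonneg _), vecNorm_sq_eq_sum, vecNorm_sq_eq_sum]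
  exact e.sum_comp fun i => v i ^ 2

theorem frobNorm_nonneg (M : Matrix m n ℝ) : 0 ≤ frobNorm M := vecNorm_nonneg _

theorem frobNorm_sq_eq_sum (M : Matrix m n ℝ) : frobNorm M ^ 2 = ∑ a, ∑ b, M a b ^ 2 := by
  rw [frobNorm, vecNorm_sq_eq_sum, Fintype.sum_prod_type]

theorem frobNorm_sq (M : Matrix m n ℝ) : frobNorm M ^ 2 = frobSq M := by
  rw [frobNorm_sq_eq_sum]
  simp only [frobSq, frobInner, sq]

theorem frobNorm_sub_le (M K : Matrix m n ℝ) : frobNorm (M - K) ≤ frobNorm M + frobNorm K :=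
  vecNorm_sub_le _ _

theorem frobNorm_smul (c : ℝ) (M : Matrix m n ℝ) : frobNorm (c • M) = |c| * frobNorm M :=
  vecNorm_smul _ _

theorem frobNorm_transpose (M : Matrix m n ℝ) : frobNorm Mᵀ = frobNorm M := by
  rw [← sq_eq_sq₀ (frobNorm_nonneg _) (frobNorm_nonneg _), frobNorm_sq_eq_sum,
    frobNorm_sq_eq_sum, Finset.sum_comm]
  rfl

theorem frobNorm_submatrix_left (e : l ≃ m) (M : Matrix m n ℝ) :
    frobNorm (M.submatrix e id) = frobNorm M := by
  rw [← sq_eq_sq₀ (frobNorm_nonneg _) (frobNorm_nonneg _), frobNorm_sq_eq_sum,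
    frobNorm_sq_eq_sum]
  exact e.sum_comp fun a => ∑ b, M a b ^ 2

theorem frobNorm_sq_eq_sum_col (M : Matrix m n ℝ) :
    frobNorm M ^ 2 = ∑ b, vecNorm (fun a => M a b) ^ 2 := by
  simp_rw [vecNorm_sq_eq_sum]
  rw [frobNorm_sq_eq_sum, Finset.sum_comm]

theorem frobNorm_sq_eq_sum_row (M : Matrix m n ℝ) :
    frobNorm M ^ 2 = ∑ a, vecNorm (fun b => M a b) ^ 2 := by
  simp_rw [vecNorm_sq_eq_sum]
  rw [frobNorm_sq_eq_sum]

theorem frobInner_eq_trace (A B : Matrix m n ℝ) : frobInner A B = (Aᵀ * B).trace := by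
  simp only [frobInner, trace, diag, mul_apply, transpose_apply]
  exact Finset.sum_comm

theorem frobSq_eq_trace (A : Matrix m n ℝ) : frobSq A = (Aᵀ * A).trace := frobInner_eq_trace A A

theorem OpLe.add {M K : Matrix m n ℝ} {c c' : ℝ} (h : OpLe M c) (h' : OpLe K c') :
    OpLe (M + K) (c + c') := fun v => by
  rw [add_mulVec, add_mul]
  exact (vecNorm_add_le _ _).trans (add_le_add (h v) (h' v))

theorem OpLe.mono {M : Matrix m n ℝ} {c c' : ℝ} (h : OpLe M c) (hc : c ≤ c') : OpLe M c' :=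
  fun v => (h v).trans (mul_le_mul_of_nonneg_right hc (vecNorm_nonneg _))

theorem OpLe.mul {M : Matrix l m ℝ} {K : Matrix m n ℝ} {c c' : ℝ} (hc : 0 ≤ c) (h : OpLe M c)
    (h' : OpLe K c') : OpLe (M * K) (c * c') := fun v => by
  rw [← mulVec_mulVec, mul_assoc]
  exact (h _).trans (mul_le_mul_of_nonneg_left (h' v) hc)

theorem OpLe.frobNorm_mul_le {M : Matrix l m ℝ} {c : ℝ} (hc : 0 ≤ c) (h : OpLe M c)
    (Y : Matrix m n ℝ) : frobNorm (M * Y) ≤ c * frobNorm Y := by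
  refine le_of_sq_le_sq ?_ (mul_nonneg hc (frobNorm_nonneg _))
  rw [mul_pow, frobNorm_sq_eq_sum_col, frobNorm_sq_eq_sum_col, Finset.mul_sum]
  refine Finset.sum_le_sum fun b _ => ?_
  rw [← mul_pow]
  exact pow_le_pow_left₀ (vecNorm_nonneg _) (h fun a => Y a b) 2

/-- Since `‖Mᵀw‖² = ⟨w, M Mᵀw⟩ ≤ ‖w‖ c ‖Mᵀw‖`, one factor cancels. -/
theorem OpLe.transpose {M : Matrix m n ℝ} {c : ℝ} (hc : 0 ≤ c) (h : OpLe M c) : OpLe Mᵀ c := by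
  intro w
  rcases (vecNorm_nonneg (Mᵀ *ᵥ w)).eq_or_lt with h0 | h0
  · rw [← h0]
    exact mul_nonneg hc (vecNorm_nonneg _)
  · refine le_of_mul_le_mul_right ?_ h0
    calc vecNorm (Mᵀ *ᵥ w) * vecNorm (Mᵀ *ᵥ w) = (Mᵀ *ᵥ w) ⬝ᵥ (Mᵀ *ᵥ w) := by
          rw [← vecNorm_sq, sq]
      _ = w ⬝ᵥ (M *ᵥ (Mᵀ *ᵥ w)) := by
          rw [dotProduct_mulVec w, mulVec_transpose]
      _ ≤ vecNorm w * (c * vecNorm (Mᵀ *ᵥ w)) :=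
          (le_abs_self _).trans <| (abs_dotProduct_le _ _).trans <|
            mul_le_mul_of_nonneg_left (h _) (vecNorm_nonneg _)
      _ = c * vecNorm w * vecNorm (Mᵀ *ᵥ w) := by ring

theorem OpLe.frobNorm_mul_le' {M : Matrix m n ℝ} {c : ℝ} (hc : 0 ≤ c) (h : OpLe M c)
    (Y : Matrix l m ℝ) : frobNorm (Y * M) ≤ frobNorm Y * c := by
  rw [← frobNorm_transpose, transpose_mul, ← frobNorm_transpose Y, mul_comm]
  exact (h.transpose hc).frobNorm_mul_le hc _

theorem opLe_frobNorm (M : Matrix m n ℝ) : OpLe M (frobNorm M) := by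
  intro v
  refine le_of_sq_le_sq ?_ (mul_nonneg (frobNorm_nonneg _) (vecNorm_nonneg _))
  rw [mul_pow, frobNorm_sq_eq_sum_row, vecNorm_sq_eq_sum, Finset.sum_mul]
  refine Finset.sum_le_sum fun a _ => ?_
  rw [← sq_abs, ← mul_pow]
  exact pow_le_pow_left₀ (abs_nonneg _) (abs_dotProduct_le _ _) 2

theorem OpLe.submatrix_left {M : Matrix m n ℝ} {c : ℝ} (h : OpLe M c) (e : l ≃ m) :
    OpLe (M.submatrix e id) c := by
  intro v
  have : M.submatrix e id *ᵥ v = (M *ᵥ v) ∘ e := rfl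
  rw [this, vecNorm_comp_equiv]
  exact h v

theorem vecNorm_mulVec_of_isometry [DecidableEq n] {M : Matrix m n ℝ} (h : Mᵀ * M = 1)
    (v : n → ℝ) : vecNorm (M *ᵥ v) = vecNorm v := by
  rw [← sq_eq_sq₀ (vecNorm_nonneg _) (vecNorm_nonneg _), vecNorm_sq, vecNorm_sq,
    dotProduct_mulVec, ← mulVec_transpose, mulVec_mulVec, h, one_mulVec]

theorem opLe_of_isometry [DecidableEq n] {M : Matrix m n ℝ} (h : Mᵀ * M = 1) : OpLe M 1 :=
  fun v => by rw [vecNorm_mulVec_of_isometry h, one_mul]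

theorem frobNorm_mul_of_isometry [DecidableEq m] {M : Matrix l m ℝ} (h : Mᵀ * M = 1)
    (Y : Matrix m n ℝ) : frobNorm (M * Y) = frobNorm Y := by
  rw [← sq_eq_sq₀ (frobNorm_nonneg _) (frobNorm_nonneg _), frobNorm_sq, frobNorm_sq,
    frobSq_eq_trace, frobSq_eq_trace, transpose_mul, Matrix.mul_assoc, ← Matrix.mul_assoc Mᵀ, h,
    Matrix.one_mul]

theorem frobNorm_sq_of_isometry [DecidableEq n] {M : Matrix m n ℝ} (h : Mᵀ * M = 1) :
    frobNorm M ^ 2 = Fintype.card n := by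
  rw [frobNorm_sq, frobSq_eq_trace, h, trace_one]

/-- Pythagoras for the orthogonal projection `P Pᵀ`. -/
theorem frobNorm_sq_sub_mul_transpose_mul [DecidableEq m] {P : Matrix l m ℝ} (h : Pᵀ * P = 1)
    (M : Matrix l n ℝ) :
    frobNorm (M - P * (Pᵀ * M)) ^ 2 = frobNorm M ^ 2 - frobNorm (Pᵀ * M) ^ 2 := by
  simp only [frobNorm_sq, frobSq_eq_trace]
  rw [← trace_sub]
  congr 1
  simp only [transpose_sub, transpose_mul, transpose_transpose, Matrix.sub_mul, Matrix.mul_sub]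
  have : Mᵀ * P * Pᵀ * (P * (Pᵀ * M)) = Mᵀ * P * (Pᵀ * M) := by
    rw [Matrix.mul_assoc (Mᵀ * P) Pᵀ, ← Matrix.mul_assoc Pᵀ, h, Matrix.one_mul]
  simp only [Matrix.mul_assoc] at this ⊢
  rw [this]
  abel

/-- The matrix is block diagonal with all blocks equal to `M`, so the bound holds block by block. -/
theorem opLe_one_kronecker [DecidableEq o] {M : Matrix m n ℝ} {c : ℝ} (hc : 0 ≤ c)
    (h : OpLe M c) : OpLe (kroneckerMap (· * ·) (1 : Matrix o o ℝ) M) c := by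
  intro v
  have key : ∀ t : o, (fun a => (kroneckerMap (· * ·) (1 : Matrix o o ℝ) M *ᵥ v) (t, a)) =
      M *ᵥ fun b => v (t, b) := by
    intro t
    ext a
    simp only [mulVec, dotProduct, Fintype.sum_prod_type, kroneckerMap_apply, one_apply, ite_mul,
      one_mul, zero_mul]
    rw [Finset.sum_eq_single t]
    · simp
    · intro t' _ ht
      simp [ht.symm]
    · simp
  refine le_of_sq_le_sq ?_ (mul_nonneg hc (vecNorm_nonneg _))
  rw [mul_pow, vecNorm_sq_eq_sum, vecNorm_sq_eq_sum, Fintype.sum_prod_type,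
    Fintype.sum_prod_type, Finset.mul_sum]
  refine Finset.sum_le_sum fun t _ => ?_
  rw [← vecNorm_sq_eq_sum (fun a => (kroneckerMap (· * ·) (1 : Matrix o o ℝ) M *ᵥ v) (t, a)),
    ← vecNorm_sq_eq_sum (fun b => v (t, b)), key, ← mul_pow]
  exact pow_le_pow_left₀ (vecNorm_nonneg _) (h _) 2

omit [Fintype n] in
theorem isometry_one_kronecker [DecidableEq o] [DecidableEq n] {M : Matrix m n ℝ}
    (h : Mᵀ * M = 1) :
    (kroneckerMap (· * ·) (1 : Matrix o o ℝ) M)ᵀ *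
      kroneckerMap (· * ·) (1 : Matrix o o ℝ) M = 1 := by
  rw [← kroneckerMap_transpose, transpose_one, ← mul_kronecker_mul, h, Matrix.one_mul,
    one_kronecker_one]

omit [Fintype n] in
theorem isometry_mul [DecidableEq m] [DecidableEq n] {P : Matrix l m ℝ} {M : Matrix m n ℝ}
    (hP : Pᵀ * P = 1) (h : Mᵀ * M = 1) : (P * M)ᵀ * (P * M) = 1 := by
  rw [transpose_mul, Matrix.mul_assoc, ← Matrix.mul_assoc Pᵀ, hP, Matrix.one_mul, h]

/-- Transposition and cyclicity of the trace turn the two correction terms of one side into those of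
the other. This lets the projection act on the factor difference instead of the subgradient. -/
theorem frobInner_tangentProj (L A B : Matrix m n ℝ) :
    frobInner A (tangentProj L B) = frobInner (tangentProj L A) B := by
  simp only [frobInner_eq_trace, tangentProj, transpose_sub, transpose_smul, transpose_mul,
    transpose_add, transpose_transpose, Matrix.mul_sub, Matrix.sub_mul, trace_sub,
    Matrix.mul_smul, Matrix.smul_mul, trace_smul, Matrix.mul_add, Matrix.add_mul, trace_add]
  have h1 : (Aᵀ * (L * (Bᵀ * L))).trace = (Lᵀ * A * Lᵀ * B).trace := by
    rw [← trace_transpose]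
    simp only [transpose_mul, transpose_transpose]
    rw [Matrix.mul_assoc, trace_mul_comm, ← Matrix.mul_assoc]
  have h2 : (Aᵀ * (L * (Lᵀ * B))).trace = (Aᵀ * L * Lᵀ * B).trace := by
    simp only [Matrix.mul_assoc]
  rw [h1, h2]

/-- Both `(L - K)ᵀL + Lᵀ(L - K)` and `(L - K)ᵀ(L - K)` equal `2 - KᵀL - LᵀK`. Hence the projection
changes a difference of two Stiefel points only to second order. -/
theorem tangentProj_sub_of_isometry [DecidableEq n] {L K : Matrix m n ℝ} (hL : Lᵀ * L = 1)
    (hK : Kᵀ * K = 1) :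
    tangentProj L (L - K) = (L - K) - (1 / 2 : ℝ) • (L * ((L - K)ᵀ * (L - K))) := by
  rw [tangentProj]
  congr 3
  simp only [transpose_sub, Matrix.sub_mul, Matrix.mul_sub, hL, hK]
  abel

end MatrixNorms

/-! ### Lower bounds by the smallest nonzero singular value, and stability of the rank. -/

section SingularValues

variable {m n : Type} [Fintype m] [Fintype n] [DecidableEq m] [DecidableEq n]

omit [DecidableEq m] in
/-- The singular vectors: an orthonormal basis `b` in which `‖M v‖²` is diagonal, with squared
singular values on the diagonal. -/
theorem exists_orthonormalBasis_singularValues (M : Matrix m n ℝ) :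
    ∃ b : OrthonormalBasis (Fin (Fintype.card n)) ℝ (EuclideanSpace ℝ n),
      (∀ v, ‖M.toEuclideanLin v‖ ^ 2 =
        ∑ i : Fin (Fintype.card n), M.toEuclideanLin.singularValues i ^ 2 * inner ℝ (b i) v ^ 2) ∧
      ∀ i : Fin (Fintype.card n), ‖M.toEuclideanLin (b i)‖ = M.toEuclideanLin.singularValues i := by
  set T := M.toEuclideanLin with hT
  have hn : Module.finrank ℝ (EuclideanSpace ℝ n) = Fintype.card n := finrank_euclideanSpace
  have hs := T.isSymmetric_adjoint_comp_self
  have key : ∀ v, ‖T v‖ ^ 2 =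
      ∑ i : Fin (Fintype.card n),
        T.singularValues i ^ 2 * inner ℝ (hs.eigenvectorBasis hn i) v ^ 2 := by
    intro v
    rw [← real_inner_self_eq_norm_sq, ← LinearMap.adjoint_inner_right, real_inner_comm,
      ← (hs.eigenvectorBasis hn).sum_inner_mul_inner]
    refine Finset.sum_congr rfl fun i _ => ?_
    have h1 : inner ℝ (LinearMap.adjoint T (T v)) (hs.eigenvectorBasis hn i) =
        T.singularValues i ^ 2 * inner ℝ (hs.eigenvectorBasis hn i) v := by
      have := hs v (hs.eigenvectorBasis hn i)
      rw [hs.apply_eigenvectorBasis hn i, inner_smul_right, ← T.sq_singularValues_fin hn i] at this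
      rw [real_inner_comm v]
      exact this
    rw [h1]
    ring
  refine ⟨hs.eigenvectorBasis hn, key, fun i => ?_⟩
  rw [← sq_eq_sq₀ (norm_nonneg _) (T.singularValues_nonneg _), key, Finset.sum_eq_single i]
  · simp
  · intro j _ hj
    rw [(hs.eigenvectorBasis hn).inner_eq_zero hj]
    simp
  · simp

omit [DecidableEq m] in
theorem vecNorm_mulVec_eq (M : Matrix m n ℝ) (v : n → ℝ) :
    vecNorm (M *ᵥ v) = ‖M.toEuclideanLin (WithLp.toLp 2 v)‖ := rfl

omit [DecidableEq m] in
theorem opLe_singularValues_zero (M : Matrix m n ℝ) :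
    OpLe M (M.toEuclideanLin.singularValues 0) := by
  intro v
  obtain ⟨b, hb, -⟩ := exists_orthonormalBasis_singularValues M
  refine le_of_sq_le_sq ?_ (mul_nonneg (LinearMap.singularValues_nonneg _ _) (vecNorm_nonneg _))
  rw [mul_pow, vecNorm_mulVec_eq, hb, vecNorm, ← b.sum_sq_inner_right, Finset.mul_sum]
  refine Finset.sum_le_sum fun i _ => mul_le_mul_of_nonneg_right ?_ (sq_nonneg _)
  exact pow_le_pow_left₀ (LinearMap.singularValues_nonneg _ _)
    (LinearMap.singularValues_antitone _ (Nat.zero_le _)) 2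

/-- On the row space, a matrix is bounded below by its smallest nonzero singular value. -/
theorem singularValues_mul_vecNorm_le (M : Matrix m n ℝ) (y : m → ℝ) :
    M.toEuclideanLin.singularValues (M.rank - 1) * vecNorm (Mᵀ *ᵥ y) ≤
      vecNorm (M *ᵥ (Mᵀ *ᵥ y)) := by
  obtain ⟨b, hb, hb'⟩ := exists_orthonormalBasis_singularValues M
  have hrank : Module.finrank ℝ (LinearMap.range M.toEuclideanLin) = M.rank := by
    rw [M.rank_eq_finrank_range_toLin (EuclideanSpace.basisFun m ℝ).toBasis
      (EuclideanSpace.basisFun n ℝ).toBasis]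
    rfl
  refine le_of_sq_le_sq ?_ (vecNorm_nonneg _)
  rw [mul_pow, vecNorm_mulVec_eq M, hb, vecNorm, ← b.sum_sq_inner_right, Finset.mul_sum]
  refine Finset.sum_le_sum fun i _ => ?_
  -- Singular vectors of value zero lie in the kernel of `M`, which is orthogonal to `Mᵀy`; all
  -- others have index below the rank, so their values dominate the one at `rank - 1`.
  rcases (LinearMap.singularValues_nonneg M.toEuclideanLin i).eq_or_lt with h0 | h0
  · have h1 : M.toEuclideanLin (b i) = 0 := by rw [← norm_eq_zero, hb', h0]
    have h2 : inner ℝ (b i) (WithLp.toLp 2 (Mᵀ *ᵥ y)) = 0 := by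
      have : WithLp.toLp 2 (Mᵀ *ᵥ y) = LinearMap.adjoint M.toEuclideanLin (WithLp.toLp 2 y) := by
        rw [← Matrix.toEuclideanLin_conjTranspose_eq_adjoint, conjTranspose_eq_transpose_of_trivial]
        rfl
      rw [this, LinearMap.adjoint_inner_right, h1, inner_zero_left]
    rw [h2]
    simp
  · rw [LinearMap.singularValues_pos_iff_lt_finrank_range, hrank] at h0
    refine mul_le_mul_of_nonneg_right ?_ (sq_nonneg _)
    exact pow_le_pow_left₀ (LinearMap.singularValues_nonneg _ _)
      (LinearMap.singularValues_antitone _ (by omega)) 2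

variable {p : Type} [Fintype p] [DecidableEq p]

/-- For a factorization with an orthonormal left factor and a full rank right factor, the right
factor is bounded below on its row space. -/
theorem singularValues_mul_vecNorm_transpose_le {P : Matrix m p ℝ} {Q : Matrix p n ℝ}
    (hP : Pᵀ * P = 1) (w : p → ℝ) :
    (P * Q).toEuclideanLin.singularValues ((P * Q).rank - 1) * vecNorm (Qᵀ *ᵥ w) ≤
      vecNorm (Q *ᵥ (Qᵀ *ᵥ w)) := by
  have h := singularValues_mul_vecNorm_le (P * Q) (P *ᵥ w)
  have h1 : (P * Q)ᵀ *ᵥ (P *ᵥ w) = Qᵀ *ᵥ w := by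
    rw [transpose_mul, mulVec_mulVec, Matrix.mul_assoc, hP, Matrix.mul_one]
  rwa [h1, ← mulVec_mulVec _ P Q, vecNorm_mulVec_of_isometry hP] at h

omit [Fintype m] [DecidableEq m] [DecidableEq n] [DecidableEq p] in
theorem mulVec_surjective_of_rank {P : Matrix m p ℝ} {Q : Matrix p n ℝ}
    (hr : (P * Q).rank = Fintype.card p) : Function.Surjective (Q * Qᵀ).mulVec := by
  have h1 : (Q * Qᵀ).rank = Fintype.card p := by
    rw [rank_self_mul_transpose]
    exact le_antisymm (rank_le_card_height Q) (hr ▸ rank_mul_le_right P Q)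
  have h2 : LinearMap.range (Q * Qᵀ).mulVecLin = ⊤ := by
    apply Submodule.eq_top_of_finrank_eq
    rw [Module.finrank_pi]
    exact h1
  exact LinearMap.range_eq_top.mp h2

/-- Full rank gives `w = Q Qᵀu`. Then `‖w‖² = ⟨Qᵀw, Qᵀu⟩ ≤ ‖Qᵀw‖ ‖Qᵀu‖`, and the row space bound
gives `σ ‖Qᵀu‖ ≤ ‖w‖`. -/
theorem singularValues_mul_vecNorm_le_transpose {P : Matrix m p ℝ} {Q : Matrix p n ℝ}
    (hP : Pᵀ * P = 1) (hr : (P * Q).rank = Fintype.card p) (w : p → ℝ) :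
    (P * Q).toEuclideanLin.singularValues ((P * Q).rank - 1) * vecNorm w ≤
      vecNorm (Qᵀ *ᵥ w) := by
  obtain ⟨u, rfl⟩ := mulVec_surjective_of_rank hr w
  set σ := (P * Q).toEuclideanLin.singularValues ((P * Q).rank - 1)
  have h := singularValues_mul_vecNorm_transpose_le (Q := Q) hP u
  rw [mulVec_mulVec] at h
  set w := (Q * Qᵀ) *ᵥ u
  rcases (vecNorm_nonneg w).eq_or_lt with h0 | h0
  · rw [← h0, mul_zero]
    exact vecNorm_nonneg _
  · refine le_of_mul_le_mul_right ?_ h0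
    have h3 : vecNorm w ^ 2 ≤ vecNorm (Qᵀ *ᵥ w) * vecNorm (Qᵀ *ᵥ u) := by
      refine le_trans (le_of_eq ?_) ((le_abs_self _).trans (abs_dotProduct_le _ _))
      rw [vecNorm_sq, mulVec_transpose Q w, ← dotProduct_mulVec, mulVec_mulVec]
    have hσ : 0 ≤ σ := LinearMap.singularValues_nonneg _ _
    calc σ * vecNorm w * vecNorm w = σ * vecNorm w ^ 2 := by ring
      _ ≤ σ * (vecNorm (Qᵀ *ᵥ w) * vecNorm (Qᵀ *ᵥ u)) := mul_le_mul_of_nonneg_left h3 hσ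
      _ = vecNorm (Qᵀ *ᵥ w) * (σ * vecNorm (Qᵀ *ᵥ u)) := by ring
      _ ≤ vecNorm (Qᵀ *ᵥ w) * vecNorm w := mul_le_mul_of_nonneg_left h (vecNorm_nonneg _)

theorem singularValues_mul_frobNorm_le {P : Matrix m p ℝ} {Q : Matrix p n ℝ}
    (hP : Pᵀ * P = 1) (hr : (P * Q).rank = Fintype.card p) {l : Type} [Fintype l]
    (Y : Matrix l p ℝ) :
    (P * Q).toEuclideanLin.singularValues ((P * Q).rank - 1) * frobNorm Y ≤ frobNorm (Y * Q) := by
  rw [← frobNorm_transpose Y, ← frobNorm_transpose (Y * Q), transpose_mul]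
  refine le_of_sq_le_sq ?_ (frobNorm_nonneg _)
  rw [mul_pow, frobNorm_sq_eq_sum_col, frobNorm_sq_eq_sum_col, Finset.mul_sum]
  refine Finset.sum_le_sum fun b _ => ?_
  rw [← mul_pow]
  exact pow_le_pow_left₀ (mul_nonneg (LinearMap.singularValues_nonneg _ _) (vecNorm_nonneg _))
    (singularValues_mul_vecNorm_le_transpose hP hr fun a => Yᵀ a b) 2

/-- A matrix at Frobenius distance less than the smallest nonzero singular value does not have a
smaller rank. -/
theorem rank_le_of_frobNorm_sub_lt {P : Matrix m p ℝ} {Q : Matrix p n ℝ}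
    (hP : Pᵀ * P = 1) (hr : (P * Q).rank = Fintype.card p) (K : Matrix m n ℝ)
    (hK : frobNorm (K - P * Q) < (P * Q).toEuclideanLin.singularValues ((P * Q).rank - 1)) :
    Fintype.card p ≤ K.rank := by
  set σ := (P * Q).toEuclideanLin.singularValues ((P * Q).rank - 1)
  have hσ : 0 < σ := (frobNorm_nonneg _).trans_lt hK
  by_contra! hlt
  -- A rank drop makes this square compression singular. On a kernel vector `w`, `Q Qᵀw` equals
  -- `-Pᵀ(K - PQ)Qᵀw`, which is too short for the lower bound on the row space.
  have h1 : (Pᵀ * K * Qᵀ).rank < Fintype.card p :=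
    ((rank_mul_le_left _ _).trans (rank_mul_le_right _ _)).trans_lt hlt
  have h2 : (Pᵀ * K * Qᵀ).det = 0 := by
    by_contra hdet
    exact h1.ne (rank_of_isUnit _ ((isUnit_iff_isUnit_det _).mpr (isUnit_iff_ne_zero.mpr hdet)))
  obtain ⟨w, hw, hw0⟩ := exists_mulVec_eq_zero_iff.mpr h2
  have h3 := singularValues_mul_vecNorm_transpose_le (Q := Q) hP w
  have h4 := singularValues_mul_vecNorm_le_transpose hP hr w
  have hw' : 0 < vecNorm w := (vecNorm_nonneg w).lt_of_ne fun h => hw (vecNorm_eq_zero h.symm)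
  have h5 : 0 < vecNorm (Qᵀ *ᵥ w) := (mul_pos hσ hw').trans_le h4
  have h6 : Q *ᵥ (Qᵀ *ᵥ w) = -(Pᵀ *ᵥ ((K - P * Q) *ᵥ (Qᵀ *ᵥ w))) := by
    rw [sub_mulVec, mulVec_sub]
    simp only [mulVec_mulVec, ← Matrix.mul_assoc]
    rw [hw0, hP, Matrix.one_mul]
    simp
  have h7 : vecNorm (Q *ᵥ (Qᵀ *ᵥ w)) ≤ frobNorm (K - P * Q) * vecNorm (Qᵀ *ᵥ w) := by
    rw [h6, ← neg_one_smul ℝ, vecNorm_smul, abs_neg, abs_one, one_mul]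
    refine ((opLe_of_isometry hP).transpose zero_le_one _).trans ?_
    rw [one_mul]
    exact opLe_frobNorm _ _
  have h8 := le_of_mul_le_mul_right (h3.trans h7) h5
  exact hK.not_ge h8

end SingularValues

/-! ### Singular value decomposition and orthogonal alignment of subspaces. -/

section Procrustes

variable {n : ℕ}

theorem transpose_mul_eq_one_of_orthonormal
    (b : OrthonormalBasis (Fin n) ℝ (EuclideanSpace ℝ (Fin n))) :
    (Matrix.of fun i j => b j i)ᵀ * (Matrix.of fun i j => b j i) =
      (1 : Matrix (Fin n) (Fin n) ℝ) := by
  ext i j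
  have := orthonormal_iff_ite.mp b.orthonormal j i
  rw [EuclideanSpace.inner_eq_star_dotProduct] at this
  simp only [mul_apply, transpose_apply, of_apply, one_apply]
  simpa [dotProduct, eq_comm] using this

/-- A singular value decomposition of a square matrix. -/
theorem exists_mul_eq_mul_diagonal (W : Matrix (Fin n) (Fin n) ℝ) :
    ∃ (A B : Matrix (Fin n) (Fin n) ℝ) (σ : Fin n → ℝ), Aᵀ * A = 1 ∧ Bᵀ * B = 1 ∧
      (∀ i, 0 ≤ σ i) ∧ W * A = B * diagonal σ := by
  have hH : (Wᵀ * W).IsHermitian := by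
    rw [IsHermitian, conjTranspose_eq_transpose_of_trivial, transpose_mul, transpose_transpose]
  set a := hH.eigenvectorBasis
  set σ : Fin n → ℝ := fun i => vecNorm (W *ᵥ (a i).ofLp) with hσ
  have hin : ∀ i j, (W *ᵥ (a i).ofLp) ⬝ᵥ (W *ᵥ (a j).ofLp) =
      hH.eigenvalues j * if i = j then 1 else 0 := by
    intro i j
    have h1 := orthonormal_iff_ite.mp a.orthonormal i j
    rw [EuclideanSpace.inner_eq_star_dotProduct] at h1
    rw [dotProduct_comm, dotProduct_mulVec, ← mulVec_transpose, mulVec_mulVec,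
      hH.mulVec_eigenvectorBasis, smul_dotProduct, ← h1]
    rfl
  set S : Set (Fin n) := {i | σ i ≠ 0}
  set f : Fin n → EuclideanSpace ℝ (Fin n) := fun i =>
    WithLp.toLp 2 ((σ i)⁻¹ • (W *ᵥ (a i).ofLp))
  have hf : Orthonormal ℝ (S.domRestrict f) := by
    rw [orthonormal_iff_ite]
    rintro ⟨i, hi⟩ ⟨j, hj⟩
    have hi' : σ i ≠ 0 := hi
    simp only [Set.domRestrict_apply, f, EuclideanSpace.inner_eq_star_dotProduct]
    rw [show star ((σ i)⁻¹ • W *ᵥ (a i).ofLp) = (σ i)⁻¹ • W *ᵥ (a i).ofLp from rfl,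
      smul_dotProduct, dotProduct_smul]
    by_cases hij : i = j
    · subst hij
      simp only [if_true, smul_eq_mul]
      rw [← vecNorm_sq]
      change (σ i)⁻¹ * ((σ i)⁻¹ * σ i ^ 2) = 1
      field_simp
    · rw [hin]
      simp [Ne.symm hij, hij]
  -- The nonzero images of the eigenvectors of `WᵀW`, once normalized, are orthonormal; the vectors
  -- added to complete the basis are only paired with `σ i = 0`.
  obtain ⟨b, hb⟩ := hf.exists_orthonormalBasis_extension_of_card_eq (by simp)
  refine ⟨Matrix.of fun i j => a j i, Matrix.of fun i j => b j i, σ,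
    transpose_mul_eq_one_of_orthonormal a, transpose_mul_eq_one_of_orthonormal b,
    fun i => vecNorm_nonneg _, ?_⟩
  ext i j
  rw [mul_diagonal]
  change (W *ᵥ (a j).ofLp) i = b j i * σ j
  by_cases hj : σ j = 0
  · rw [hj, mul_zero, vecNorm_eq_zero hj]
    rfl
  · rw [hb j hj]
    simp only [f, Pi.smul_apply, smul_eq_mul]
    field_simp

/-- For a contraction `W` there is an orthogonal `R` with `tr (Rᵀ W) ≥ ‖W‖²`. -/
theorem exists_orthogonal_frobNorm_sq_le_trace {W : Matrix (Fin n) (Fin n) ℝ} (hW : OpLe W 1) :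
    ∃ R ∈ orthogonalGroup (Fin n) ℝ, frobNorm W ^ 2 ≤ (Rᵀ * W).trace := by
  obtain ⟨A, B, σ, hA, hB, hσ, h⟩ := exists_mul_eq_mul_diagonal W
  have hA' : A * Aᵀ = 1 := mul_eq_one_comm.mp hA
  have hW' : W = B * diagonal σ * Aᵀ := by rw [← h, Matrix.mul_assoc, hA', Matrix.mul_one]
  have hσ1 : ∀ i, σ i ≤ 1 := by
    intro i
    have h1 := hW (A *ᵥ Pi.single i 1)
    rw [mulVec_mulVec, h, ← mulVec_mulVec, vecNorm_mulVec_of_isometry hB,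
      vecNorm_mulVec_of_isometry hA, diagonal_mulVec_single] at h1
    simpa [vecNorm, abs_of_nonneg (hσ i)] using h1
  -- The polar factor turns the trace into the sum of the singular values, which dominates the sum
  -- of their squares because they are at most one.
  refine ⟨B * Aᵀ, ?_, ?_⟩
  · rw [mem_orthogonalGroup_iff']
    change (B * Aᵀ)ᵀ * (B * Aᵀ) = 1
    exact isometry_mul hB (by rw [transpose_transpose, hA'])
  · have h1 : ((B * Aᵀ)ᵀ * W).trace = ∑ i, σ i := by
      rw [hW', transpose_mul, transpose_transpose, Matrix.mul_assoc, Matrix.mul_assoc B,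
        ← Matrix.mul_assoc Bᵀ, hB, Matrix.one_mul, trace_mul_comm, Matrix.mul_assoc, hA,
        Matrix.mul_one, trace_diagonal]
    have h2 : frobNorm W ^ 2 = ∑ i, σ i ^ 2 := by
      rw [hW', Matrix.mul_assoc, frobNorm_mul_of_isometry hB, ← frobNorm_transpose, transpose_mul,
        transpose_transpose, frobNorm_mul_of_isometry hA, frobNorm_transpose, frobNorm_sq,
        frobSq_eq_trace, diagonal_transpose, diagonal_mul_diagonal, trace_diagonal]
      simp only [sq]
    rw [h1, h2]
    exact Finset.sum_le_sum fun i _ => by nlinarith [hσ i, hσ1 i]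

/-- Two matrices with orthonormal columns can be aligned up to the sine of their principal
angles. -/
theorem exists_orthogonal_frobNorm_sub_le {m : Type} [Fintype m] [DecidableEq m]
    {U V : Matrix m (Fin n) ℝ} (hU : Uᵀ * U = 1) (hV : Vᵀ * V = 1) :
    ∃ R ∈ orthogonalGroup (Fin n) ℝ,
      frobNorm (U - V * R) ^ 2 ≤ 2 * frobNorm (V - U * (Uᵀ * V)) ^ 2 := by
  have hW : OpLe (Vᵀ * U) 1 := by
    simpa using ((opLe_of_isometry hV).transpose zero_le_one).mul zero_le_one (opLe_of_isometry hU)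
  obtain ⟨R, hR, h⟩ := exists_orthogonal_frobNorm_sq_le_trace hW
  refine ⟨R, hR, ?_⟩
  have hR' : Rᵀ * R = 1 := (mem_orthogonalGroup_iff' _ _).mp hR
  rw [frobNorm_sq_sub_mul_transpose_mul hU, frobNorm_sq_of_isometry hV,
    ← frobNorm_transpose (Uᵀ * V), transpose_mul, transpose_transpose]
  -- The trace is at least `‖VᵀU‖²`, and by Pythagoras `n - ‖VᵀU‖²` is the squared sine term on the
  -- right.
  have h1 : frobNorm (U - V * R) ^ 2 = 2 * Fintype.card (Fin n) - 2 * (Rᵀ * (Vᵀ * U)).trace := by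
    rw [frobNorm_sq, frobSq_eq_trace, transpose_sub, Matrix.sub_mul, Matrix.mul_sub,
      Matrix.mul_sub, trace_sub, trace_sub, trace_sub, hU, isometry_mul hV hR', trace_one]
    have : (Uᵀ * (V * R)).trace = ((V * R)ᵀ * U).trace := by
      rw [← trace_transpose, transpose_mul, transpose_transpose]
    rw [this, transpose_mul, Matrix.mul_assoc]
    ring
  rw [h1]
  linarith

end Procrustes

/-! ### Partial products, unfoldings, rotations and directional derivatives in TT format. -/

section TensorTrain

variable {N : ℕ} {d : Fin N → ℕ} {r : Fin (N + 1) → ℕ}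

/-- The values of the first `k` indices. -/
abbrev LeftIdx (d : Fin N → ℕ) (k : Fin (N + 1)) : Type :=
  (i : {i : Fin N // (i : ℕ) < (k : ℕ)}) → Fin (d i)

/-- The values of the indices after the first `k`. -/
abbrev RightIdx (d : Fin N → ℕ) (k : Fin (N + 1)) : Type :=
  (i : {i : Fin N // ¬ (i : ℕ) < (k : ℕ)}) → Fin (d i)

/-- Joining the first `k` indices with the others. -/
def joinIdx (d : Fin N → ℕ) (k : Fin (N + 1)) :
    LeftIdx d k × RightIdx d k ≃ ((i : Fin N) → Fin (d i)) :=
  (Equiv.piEquivPiSubtypeProd (fun i : Fin N => (i : ℕ) < (k : ℕ)) (fun i => Fin (d i))).symm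

theorem joinIdx_of_lt {k : Fin (N + 1)} (a : LeftIdx d k) (b : RightIdx d k) {i : Fin N}
    (hi : (i : ℕ) < (k : ℕ)) : joinIdx d k (a, b) i = a ⟨i, hi⟩ := by
  simp [joinIdx, hi]

theorem joinIdx_of_not_lt {k : Fin (N + 1)} (a : LeftIdx d k) (b : RightIdx d k) {i : Fin N}
    (hi : ¬ (i : ℕ) < (k : ℕ)) : joinIdx d k (a, b) i = b ⟨i, hi⟩ := by
  simp only [joinIdx, Equiv.piEquivPiSubtypeProd_symm_apply]
  rw [dif_neg hi]

/-- The unfolding after the first `k` indices, where `k = 0` and `k = N` are allowed. -/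
def cut (X : Tensor d) (k : Fin (N + 1)) : Matrix (LeftIdx d k) (RightIdx d k) ℝ :=
  Matrix.of fun a b => X (joinIdx d k (a, b))

theorem unfolding_eq_cut (X : Tensor d) (k : Bond N) : unfolding X k = cut X k.1 := rfl

theorem cut_sub (X Y : Tensor d) (k : Fin (N + 1)) : cut (X - Y) k = cut X k - cut Y k := rfl

theorem cut_sum {ι : Type} (s : Finset ι) (X : ι → Tensor d) (k : Fin (N + 1)) :
    cut (∑ i ∈ s, X i) k = ∑ i ∈ s, cut (X i) k := by
  ext a b
  simp [cut, Matrix.sum_apply]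

theorem frobNorm_cut (X : Tensor d) (k : Fin (N + 1)) : frobNorm (cut X k) = ‖X‖ := by
  rw [← sq_eq_sq₀ (frobNorm_nonneg _) (norm_nonneg _), frobNorm_sq_eq_sum,
    EuclideanSpace.norm_sq_eq, ← (joinIdx d k).sum_comp, Fintype.sum_prod_type]
  simp [cut]

theorem leftProd_zero (X : Factors d r) (s : (i : Fin N) → Fin (d i)) : leftProd X s 0 = 1 := rfl

theorem leftProd_succ (X : Factors d r) (s : (i : Fin N) → Fin (d i)) (i : Fin N) :
    leftProd X s i.succ = leftProd X s i.castSucc * X i (s i) := rfl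

theorem rightProd_last (X : Factors d r) (s : (i : Fin N) → Fin (d i)) :
    rightProd X s (Fin.last N) = 1 := by
  simp [rightProd]

theorem rightProd_castSucc (X : Factors d r) (s : (i : Fin N) → Fin (d i)) (i : Fin N) :
    rightProd X s i.castSucc = X i (s i) * rightProd X s i.succ := by
  simp [rightProd]

theorem leftProd_congr {X Y : Factors d r} {s t : (i : Fin N) → Fin (d i)} (k : Fin (N + 1))
    (h : ∀ i : Fin N, (i : ℕ) < (k : ℕ) → X i (s i) = Y i (t i)) :
    leftProd X s k = leftProd Y t k := by
  induction k using Fin.induction with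
  | zero => rfl
  | succ i ih =>
    rw [leftProd_succ, leftProd_succ, ih fun j hj => h j (by simp at hj ⊢; omega),
      h i (by simp)]

theorem rightProd_congr {X Y : Factors d r} {s t : (i : Fin N) → Fin (d i)} (k : Fin (N + 1))
    (h : ∀ i : Fin N, ¬ (i : ℕ) < (k : ℕ) → X i (s i) = Y i (t i)) :
    rightProd X s k = rightProd Y t k := by
  induction k using Fin.reverseInduction with
  | last => rw [rightProd_last, rightProd_last]
  | cast i ih =>
    rw [rightProd_castSucc, rightProd_castSucc, ih fun j hj => h j (by simp at hj ⊢; omega),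
      h i (by simp)]

/-- Splitting off the last of the first `i + 1` indices. -/
def splitIdx (d : Fin N → ℕ) (i : Fin N) : LeftIdx d i.succ ≃ Fin (d i) × LeftIdx d i.castSucc where
  toFun a := (a ⟨i, by simp⟩, fun j => a ⟨j.1, by have := j.2; simp at this ⊢; omega⟩)
  invFun p j := if h : (j.1 : ℕ) < (i : ℕ) then p.2 ⟨j.1, h⟩ else
    Fin.cast (by have := j.2; simp at this; rw [show j.1 = i from Fin.ext (by omega)]) p.1
  left_inv a := by
    ext ⟨j, hj⟩
    by_cases h : (j : ℕ) < (i : ℕ)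
    · simp [h]
    · obtain rfl : j = i := Fin.ext (by simp at hj; omega)
      simp
  right_inv p := by
    refine Prod.ext ?_ ?_
    · ext
      simp
    · ext ⟨j, hj⟩
      have : (j : ℕ) < (i : ℕ) := by simpa using hj
      simp only [this, dif_pos]

/-- The products of the first `i` slices of `V`, multiplied by the slices of `Y`. -/
def stepMat {i : Fin N} (M : Matrix (LeftIdx d i.castSucc) (Fin (r i.castSucc)) ℝ)
    (Y : Fin (d i) → Matrix (Fin (r i.castSucc)) (Fin (r i.succ)) ℝ) :
    Matrix (LeftIdx d i.succ) (Fin (r i.succ)) ℝ :=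
  (kroneckerMap (· * ·) (1 : Matrix (Fin (d i)) (Fin (d i)) ℝ) M * leftUnfold Y).submatrix
    (splitIdx d i) id

theorem stepMat_apply {i : Fin N} (M : Matrix (LeftIdx d i.castSucc) (Fin (r i.castSucc)) ℝ)
    (Y : Fin (d i) → Matrix (Fin (r i.castSucc)) (Fin (r i.succ)) ℝ) (a : LeftIdx d i.succ)
    (c : Fin (r i.succ)) :
    stepMat M Y a c = (M * Y (splitIdx d i a).1) (splitIdx d i a).2 c := by
  simp only [stepMat, submatrix_apply, mul_apply, Fintype.sum_prod_type, kroneckerMap_apply,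
    one_apply, ite_mul, one_mul, zero_mul, leftUnfold, of_apply, id]
  rw [Finset.sum_eq_single (splitIdx d i a).1]
  · simp
  · intro t _ ht
    simp [ht.symm]
  · simp

theorem joinIdx_splitIdx {i : Fin N} (a : LeftIdx d i.succ) {j : Fin N} (hj : (j : ℕ) < (i : ℕ))
    (b : RightIdx d i.succ) (b' : RightIdx d i.castSucc) :
    joinIdx d i.succ (a, b) j = joinIdx d i.castSucc ((splitIdx d i a).2, b') j := by
  rw [joinIdx_of_lt (k := i.succ) _ _ (by simp; omega),
    joinIdx_of_lt (k := i.castSucc) _ _ (by simpa using hj)]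
  rfl

/-- The matrix of the products of the first `k` slices. The base point fills the unused
indices. -/
def leftMat (h0 : r 0 = 1) (s₀ : (i : Fin N) → Fin (d i)) (X : Factors d r) (k : Fin (N + 1)) :
    Matrix (LeftIdx d k) (Fin (r k)) ℝ :=
  Matrix.of fun a c => leftProd X (joinIdx d k (a, fun i => s₀ i)) k ⟨0, by omega⟩ c

/-- The matrix of the products of the slices after the first `k`. -/
def rightMat (hN : r (Fin.last N) = 1) (s₀ : (i : Fin N) → Fin (d i)) (X : Factors d r)
    (k : Fin (N + 1)) : Matrix (Fin (r k)) (RightIdx d k) ℝ :=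
  Matrix.of fun c b => rightProd X (joinIdx d k (fun i => s₀ i, b)) k c ⟨0, by omega⟩

variable (h0 : r 0 = 1) (hN : r (Fin.last N) = 1) (s₀ : (i : Fin N) → Fin (d i))

theorem leftMat_congr {X Y : Factors d r} (k : Fin (N + 1))
    (h : ∀ i : Fin N, (i : ℕ) < (k : ℕ) → X i = Y i) : leftMat h0 s₀ X k = leftMat h0 s₀ Y k := by
  ext a c
  simp only [leftMat, of_apply]
  rw [leftProd_congr k fun i hi => by rw [h i hi]]

theorem rightMat_congr {X Y : Factors d r} (k : Fin (N + 1))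
    (h : ∀ i : Fin N, ¬ (i : ℕ) < (k : ℕ) → X i = Y i) :
    rightMat hN s₀ X k = rightMat hN s₀ Y k := by
  ext a c
  simp only [rightMat, of_apply]
  rw [rightProd_congr k fun i hi => by rw [h i hi]]

/-- The tensor in TT format with the factors of `V` up to `k` and the factors of `U` after `k`. -/
def glue (V U : Factors d r) (k : Fin (N + 1)) : Tensor d :=
  WithLp.toLp 2 fun s => (leftProd V s k * rightProd U s k) ⟨0, by omega⟩ ⟨0, by omega⟩

/-- The tensor in TT format with the factors of `V` before `i`, the factor `Y` at `i`, and the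
factors of `U` after `i`. -/
def sandwich (V : Factors d r) (i : Fin N)
    (Y : Fin (d i) → Matrix (Fin (r i.castSucc)) (Fin (r i.succ)) ℝ) (U : Factors d r) :
    Tensor d :=
  WithLp.toLp 2 fun s =>
    (leftProd V s i.castSucc * Y (s i) * rightProd U s i.succ) ⟨0, by omega⟩ ⟨0, by omega⟩

theorem leftProd_mul_rightProd (X : Factors d r) (s : (i : Fin N) → Fin (d i))
    (k : Fin (N + 1)) : leftProd X s k * rightProd X s k = leftProd X s (Fin.last N) := by
  induction k using Fin.reverseInduction with
  | last => rw [rightProd_last, Matrix.mul_one]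
  | cast i ih => rw [rightProd_castSucc, ← Matrix.mul_assoc, ← leftProd_succ, ih]

theorem glue_self (X : Factors d r) (k : Fin (N + 1)) : glue h0 hN X X k = ttTensor h0 hN X := by
  simp only [glue, ttTensor, leftProd_mul_rightProd]

theorem glue_zero (V U : Factors d r) : glue h0 hN V U 0 = ttTensor h0 hN U := by
  rw [← glue_self h0 hN U 0]
  rfl

theorem glue_last (V U : Factors d r) : glue h0 hN V U (Fin.last N) = ttTensor h0 hN V := by
  rw [← glue_self h0 hN V (Fin.last N)]
  simp only [glue, rightProd_last]

theorem glue_castSucc (V U : Factors d r) (i : Fin N) :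
    glue h0 hN V U i.castSucc = sandwich h0 hN V i (U i) U := by
  simp only [glue, sandwich, rightProd_castSucc, Matrix.mul_assoc]

theorem glue_succ (V U : Factors d r) (i : Fin N) :
    glue h0 hN V U i.succ = sandwich h0 hN V i (V i) U := by
  simp only [glue, sandwich, leftProd_succ]

theorem sandwich_sub (V : Factors d r) (i : Fin N)
    (Y Z : Fin (d i) → Matrix (Fin (r i.castSucc)) (Fin (r i.succ)) ℝ) (U : Factors d r) :
    sandwich h0 hN V i (Y - Z) U = sandwich h0 hN V i Y U - sandwich h0 hN V i Z U := by
  ext s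
  simp [sandwich, Matrix.mul_sub, Matrix.sub_mul]

theorem sandwich_self (U : Factors d r) (i : Fin N)
    (Y : Fin (d i) → Matrix (Fin (r i.castSucc)) (Fin (r i.succ)) ℝ) :
    sandwich h0 hN U i Y U = ttTensor h0 hN (Function.update U i Y) := by
  rw [← glue_self h0 hN _ i.succ, glue_succ, Function.update_self]
  simp only [sandwich]
  congr 1
  ext s
  rw [leftProd_congr (X := U) (Y := Function.update U i Y) (t := s) i.castSucc fun j hj => by
      rw [Function.update_of_ne (by rintro rfl; simp at hj)],
    rightProd_congr (X := U) (Y := Function.update U i Y) (t := s) i.succ fun j hj => by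
      rw [Function.update_of_ne (by rintro rfl; simp at hj)]]

/-- The telescoping sum for the difference of two tensors in TT format. -/
theorem ttTensor_sub_ttTensor (U V : Factors d r) :
    ttTensor h0 hN U - ttTensor h0 hN V = ∑ i, sandwich h0 hN V i (U i - V i) U := by
  have h : ∀ i : Fin N, sandwich h0 hN V i (U i - V i) U =
      glue h0 hN V U i.castSucc - glue h0 hN V U i.succ := fun i => by
    rw [sandwich_sub, glue_castSucc, glue_succ]
  simp only [h, Finset.sum_sub_distrib]
  -- Splitting the sum of all glued tensors at its first and at its last term gives the telescoping
  -- identity.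
  have h1 := Fin.sum_univ_succ fun k => glue h0 hN V U k
  have h2 := Fin.sum_univ_castSucc fun k => glue h0 hN V U k
  rw [← glue_zero h0 hN V U, ← glue_last h0 hN V U, sub_eq_sub_iff_add_eq_add, ← h1, h2, add_comm]

theorem cut_glue (V U : Factors d r) (k : Fin (N + 1)) :
    cut (glue h0 hN V U k) k = leftMat h0 s₀ V k * rightMat hN s₀ U k := by
  ext a b
  simp only [cut, glue, leftMat, rightMat, mul_apply, of_apply]
  refine Finset.sum_congr rfl fun c _ => ?_
  rw [leftProd_congr (X := V) (Y := V) (t := joinIdx d k (a, fun i => s₀ i)) k fun i hi => by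
      rw [joinIdx_of_lt _ _ hi, joinIdx_of_lt _ _ hi],
    rightProd_congr (X := U) (Y := U) (t := joinIdx d k (fun i => s₀ i, b)) k fun i hi => by
      rw [joinIdx_of_not_lt _ _ hi, joinIdx_of_not_lt _ _ hi]]

theorem cut_ttTensor (X : Factors d r) (k : Fin (N + 1)) :
    cut (ttTensor h0 hN X) k = leftMat h0 s₀ X k * rightMat hN s₀ X k := by
  rw [← glue_self h0 hN X k, cut_glue h0 hN s₀]

theorem leftMat_succ (V : Factors d r) (i : Fin N) :
    leftMat h0 s₀ V i.succ = stepMat (leftMat h0 s₀ V i.castSucc) (V i) := by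
  ext a c
  rw [stepMat_apply]
  simp only [leftMat, mul_apply, of_apply, leftProd_succ]
  rw [leftProd_congr (X := V) (Y := V)
    (t := joinIdx d i.castSucc ((splitIdx d i a).2, fun i => s₀ i)) i.castSucc fun j hj => by
      rw [joinIdx_splitIdx a (by simpa using hj)]]
  rw [joinIdx_of_lt _ _ (by simp)]
  rfl

theorem cut_sandwich (V : Factors d r) (i : Fin N)
    (Y : Fin (d i) → Matrix (Fin (r i.castSucc)) (Fin (r i.succ)) ℝ) (U : Factors d r) :
    cut (sandwich h0 hN V i Y U) i.succ =
      stepMat (leftMat h0 s₀ V i.castSucc) Y * rightMat hN s₀ U i.succ := by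
  -- Cutting after position `i` puts `Y` on the left side, as the last factor of an updated family.
  have h : sandwich h0 hN V i Y U = glue h0 hN (Function.update V i Y) U i.succ := by
    rw [glue_succ, Function.update_self]
    simp only [sandwich]
    congr 1
    ext s
    rw [leftProd_congr (X := V) (Y := Function.update V i Y) (t := s) i.castSucc fun j hj => by
      rw [Function.update_of_ne (by rintro rfl; simp at hj)]]
  rw [h, cut_glue h0 hN s₀, leftMat_succ, Function.update_self,
    leftMat_congr (X := Function.update V i Y) (Y := V) h0 s₀ i.castSucc fun j hj => by
      rw [Function.update_of_ne (by rintro rfl; simp at hj)]]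

section StepMat

variable {i : Fin N} {M K : Matrix (LeftIdx d i.castSucc) (Fin (r i.castSucc)) ℝ}
  {Y Z : Fin (d i) → Matrix (Fin (r i.castSucc)) (Fin (r i.succ)) ℝ}

theorem stepMat_sub_left : stepMat (M - K) Y = stepMat M Y - stepMat K Y := by
  ext a c
  simp only [stepMat_apply, Matrix.sub_mul, Matrix.sub_apply]

theorem stepMat_sub_right : stepMat M (Y - Z) = stepMat M Y - stepMat M Z := by
  ext a c
  simp only [stepMat_apply, Matrix.mul_sub, Matrix.sub_apply, Pi.sub_apply]

theorem frobNorm_stepMat_le {c : ℝ} (hc : 0 ≤ c) (hM : OpLe M c) :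
    frobNorm (stepMat M Y) ≤ c * frobNorm (leftUnfold Y) := by
  rw [stepMat, frobNorm_submatrix_left]
  exact (opLe_one_kronecker hc hM).frobNorm_mul_le hc _

/-- Left-orthogonality enters here: a factor can be measured through its product with the preceding
ones, without loss. -/
theorem frobNorm_stepMat_of_isometry (hM : Mᵀ * M = 1) :
    frobNorm (stepMat M Y) = frobNorm (leftUnfold Y) := by
  rw [stepMat, frobNorm_submatrix_left]
  exact frobNorm_mul_of_isometry (isometry_one_kronecker hM) _

theorem opLe_stepMat {c c' : ℝ} (hc : 0 ≤ c) (hM : OpLe M c) (hY : OpLe (leftUnfold Y) c') :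
    OpLe (stepMat M Y) (c * c') :=
  ((opLe_one_kronecker hc hM).mul hc hY).submatrix_left _

theorem stepMat_isometry (hM : Mᵀ * M = 1) (hY : (leftUnfold Y)ᵀ * leftUnfold Y = 1) :
    (stepMat M Y)ᵀ * stepMat M Y = 1 := by
  rw [stepMat, transpose_submatrix, submatrix_mul_equiv]
  rw [isometry_mul (isometry_one_kronecker hM) hY, submatrix_id_id]

end StepMat

theorem leftMat_zero (U V : Factors d r) : leftMat h0 s₀ U 0 = leftMat h0 s₀ V 0 := rfl

/-- Each step multiplies a block diagonal isometry by the next left unfolding. The last factor is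
not orthogonal, hence the restriction on `k`. -/
theorem leftMat_isometry {X : Factors d r} (hX : LeftOrthogonal X) (k : Fin (N + 1))
    (hk : (k : ℕ) < N) : (leftMat h0 s₀ X k)ᵀ * leftMat h0 s₀ X k = 1 := by
  induction k using Fin.induction with
  | zero =>
    have : IsEmpty {i : Fin N // (i : ℕ) < ((0 : Fin (N + 1)) : ℕ)} := ⟨fun i => by simpa using i.2⟩
    have : Subsingleton (Fin (r 0)) := by rw [h0]; infer_instance
    ext c c'
    rw [mul_apply, Fintype.sum_unique, Subsingleton.elim c ⟨0, by omega⟩,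
      Subsingleton.elim c' ⟨0, by omega⟩]
    simp [leftMat, leftProd_zero]
  | succ i ih =>
    rw [leftMat_succ]
    exact stepMat_isometry (ih (by simp)) (hX i (by simpa using hk))

theorem rightMat_last_isometry (X : Factors d r) :
    rightMat hN s₀ X (Fin.last N) * (rightMat hN s₀ X (Fin.last N))ᵀ = 1 := by
  have : IsEmpty {i : Fin N // ¬ (i : ℕ) < ((Fin.last N : Fin (N + 1)) : ℕ)} :=
    ⟨fun i => i.2 (by simp)⟩
  have : Subsingleton (Fin (r (Fin.last N))) := by rw [hN]; infer_instance
  ext c c'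
  rw [mul_apply, Fintype.sum_unique, Subsingleton.elim c ⟨0, by omega⟩,
    Subsingleton.elim c' ⟨0, by omega⟩]
  simp [rightMat, rightProd_last]

theorem frobNorm_mul_rightMat_last (X : Factors d r) {l : Type} [Fintype l]
    (M : Matrix l (Fin (r (Fin.last N))) ℝ) :
    frobNorm (M * rightMat hN s₀ X (Fin.last N)) = frobNorm M := by
  rw [← frobNorm_transpose, transpose_mul, frobNorm_mul_of_isometry, frobNorm_transpose]
  rw [transpose_transpose]
  exact rightMat_last_isometry hN s₀ X

theorem ttRank_le_of_eq_mul {X : Tensor d} {k : Bond N} {p : ℕ}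
    {P : Matrix (LeftIdx d k.1) (Fin p) ℝ} {Q : Matrix (Fin p) (RightIdx d k.1) ℝ}
    (h : cut X k.1 = P * Q) : ttRank X k ≤ p := by
  rw [ttRank, unfolding_eq_cut, h]
  exact (rank_mul_le_left _ _).trans (rank_le_card_width P |>.trans_eq (Fintype.card_fin p))

section Rotate

variable {R : (k : Fin (N + 1)) → Matrix (Fin (r k)) (Fin (r k)) ℝ}

/-- Interior rotations cancel, so only the rotation at bond `k` survives; this is why bonds can be
aligned independently. -/
theorem leftProd_rotate (hR : R ∈ Rotations r) (X : Factors d r) (s : (i : Fin N) → Fin (d i))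
    (k : Fin (N + 1)) : leftProd (rotate R X) s k = leftProd X s k * R k := by
  induction k using Fin.induction with
  | zero => rw [leftProd_zero, leftProd_zero, hR.2.1, Matrix.one_mul]
  | succ i ih =>
    have h : R i.castSucc * (R i.castSucc)ᵀ = 1 := (mem_orthogonalGroup_iff _ _).mp (hR.1 _)
    rw [leftProd_succ, leftProd_succ, ih, rotate]
    simp only [Matrix.mul_assoc]
    rw [← Matrix.mul_assoc (R i.castSucc) (R i.castSucc)ᵀ, h, Matrix.one_mul]

theorem leftMat_rotate (hR : R ∈ Rotations r) (X : Factors d r) (k : Fin (N + 1)) :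
    leftMat h0 s₀ (rotate R X) k = leftMat h0 s₀ X k * R k := by
  ext a c
  simp only [leftMat, of_apply, leftProd_rotate hR, mul_apply]

theorem ttTensor_rotate (hR : R ∈ Rotations r) (X : Factors d r) :
    ttTensor h0 hN (rotate R X) = ttTensor h0 hN X := by
  simp only [ttTensor, leftProd_rotate hR, hR.2.2, Matrix.mul_one]

theorem leftOrthogonal_rotate (hR : R ∈ Rotations r) {X : Factors d r} (hX : LeftOrthogonal X) :
    LeftOrthogonal (rotate R X) := by
  intro i hi
  have h : R i.castSucc * (R i.castSucc)ᵀ = 1 := (mem_orthogonalGroup_iff _ _).mp (hR.1 _)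
  have h' : (R i.succ)ᵀ * R i.succ = 1 := (mem_orthogonalGroup_iff' _ _).mp (hR.1 _)
  have h1 : leftUnfold (rotate R X i) = kroneckerMap (· * ·) (1 : Matrix (Fin (d i)) (Fin (d i)) ℝ)
      (R i.castSucc)ᵀ * (leftUnfold (X i) * R i.succ) := by
    ext ⟨t, a⟩ c
    simp only [leftUnfold, rotate, of_apply, mul_apply, Fintype.sum_prod_type, kroneckerMap_apply,
      one_apply, ite_mul, one_mul, zero_mul]
    rw [Finset.sum_eq_single t]
    · simp only [if_true, Finset.sum_mul, Finset.mul_sum, mul_assoc]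
      exact Finset.sum_comm
    · intro t' _ ht
      simp [ht.symm]
    · simp
  rw [h1]
  refine isometry_mul (isometry_one_kronecker ?_) (isometry_mul (hX i hi) h')
  rw [transpose_transpose, h]

end Rotate

/-- The chain rule: the tensor is linear in its `i`-th factor, with derivative `Y ↦ sandwich U i Y
U`, and the subgradient is the adjoint of this map applied to the signed measurements. -/
theorem frobInner_subgrad {m : ℕ} (A : Fin m → Tensor d) (y : Fin m → ℝ) (U : Factors d r)
    (i : Fin N) (Y : Fin (d i) → Matrix (Fin (r i.castSucc)) (Fin (r i.succ)) ℝ) :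
    frobInner (leftUnfold Y) (leftUnfold (subgrad h0 hN A y U i)) =
      1 / (m : ℝ) * ∑ k, Real.sign (inner ℝ (A k) (ttTensor h0 hN U) - y k) *
        inner ℝ (A k) (sandwich h0 hN U i Y U) := by
  have key : ∀ k, inner ℝ (A k) (sandwich h0 hN U i Y U) = ∑ t, ∑ a, ∑ b, Y t a b *
      ∑ s ∈ Finset.univ.filter (fun s : (j : Fin N) → Fin (d j) => s i = t),
        A k s * (leftProd U s i.castSucc ⟨0, by omega⟩ a *
          rightProd U s i.succ b ⟨0, by omega⟩) := by
    intro k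
    rw [PiLp.inner_apply, ← Finset.sum_fiberwise Finset.univ (fun s => s i)]
    refine Finset.sum_congr rfl fun t _ => ?_
    simp only [Finset.mul_sum]
    rw [Finset.sum_congr rfl fun a _ => Finset.sum_comm, Finset.sum_comm]
    refine Finset.sum_congr rfl fun s hs => ?_
    obtain rfl : s i = t := (Finset.mem_filter.mp hs).2
    simp only [sandwich, mul_apply, Finset.sum_mul, RCLike.inner_apply, conj_trivial]
    rw [Finset.sum_comm]
    refine Finset.sum_congr rfl fun a _ => Finset.sum_congr rfl fun b _ => ?_
    ring
  simp only [key]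
  let S := fun (k : Fin m) t a b =>
    ∑ s ∈ Finset.univ.filter (fun s : (j : Fin N) → Fin (d j) => s i = t),
      A k s * (leftProd U s i.castSucc ⟨0, by omega⟩ a * rightProd U s i.succ b ⟨0, by omega⟩)
  change ∑ p : Fin (d i) × Fin (r i.castSucc), ∑ b, Y p.1 p.2 b * (1 / (m : ℝ) * ∑ k,
      Real.sign (inner ℝ (A k) (ttTensor h0 hN U) - y k) * S k p.1 p.2 b) =
    1 / (m : ℝ) * ∑ k, Real.sign (inner ℝ (A k) (ttTensor h0 hN U) - y k) *
      ∑ t, ∑ a, ∑ b, Y t a b * S k t a b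
  generalize S = S
  simp only [Fintype.sum_prod_type, Finset.mul_sum]
  rw [Finset.sum_comm (s := (Finset.univ : Finset (Fin m)))]
  refine Finset.sum_congr rfl fun t _ => ?_
  rw [Finset.sum_comm (s := (Finset.univ : Finset (Fin m)))]
  refine Finset.sum_congr rfl fun a _ => ?_
  rw [Finset.sum_comm (s := (Finset.univ : Finset (Fin m)))]
  refine Finset.sum_congr rfl fun b _ => Finset.sum_congr rfl fun k _ => ?_
  ring

end TensorTrain

theorem rank_add_le {m n : Type} [Fintype m] [Fintype n] (A B : Matrix m n ℝ) :
    (A + B).rank ≤ A.rank + B.rank := by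
  have h : LinearMap.range (A + B).mulVecLin ≤
      LinearMap.range A.mulVecLin ⊔ LinearMap.range B.mulVecLin := by
    rintro _ ⟨v, rfl⟩
    rw [mulVecLin_add]
    exact Submodule.add_mem_sup ⟨v, rfl⟩ ⟨v, rfl⟩
  exact (Submodule.finrank_mono h).trans (Submodule.finrank_add_le_finrank_add_finrank _ _)

theorem rank_mul_le_card {m n : Type} [Fintype m] [Fintype n] {p : ℕ} (P : Matrix m (Fin p) ℝ)
    (Q : Matrix (Fin p) n ℝ) : (P * Q).rank ≤ p :=
  (rank_mul_le_left _ _).trans ((rank_le_card_width P).trans_eq (Fintype.card_fin p))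

/-- The sum over pairs `j < i` and half the diagonal make up half the square of the sum. -/
theorem sum_mul_sum_lt_add_half_sq {N : ℕ} (t : Fin N → ℝ) :
    ∑ i : Fin N, ((∑ j : Fin N, if (j : ℕ) < (i : ℕ) then t j else 0) * t i + 1 / 2 * t i ^ 2) =
      1 / 2 * (∑ i, t i) ^ 2 := by
  have h1 : ∑ i : Fin N, ∑ j : Fin N, (if (j : ℕ) < (i : ℕ) then t j * t i else 0) =
      ∑ i : Fin N, ∑ j : Fin N, if (i : ℕ) < (j : ℕ) then t i * t j else 0 := Finset.sum_comm
  have h2 : (∑ i, t i) ^ 2 =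
      ∑ i : Fin N, ∑ j : Fin N, (if (j : ℕ) < (i : ℕ) then t j * t i else 0) +
      ∑ i : Fin N, ∑ j : Fin N, (if (i : ℕ) < (j : ℕ) then t i * t j else 0) + ∑ i, t i ^ 2 := by
    rw [sq, Finset.sum_mul_sum, ← Finset.sum_add_distrib, ← Finset.sum_add_distrib]
    refine Finset.sum_congr rfl fun i _ => ?_
    have h3 : t i ^ 2 = ∑ j : Fin N, if i = j then t i * t j else 0 := by simp [sq]
    rw [h3, ← Finset.sum_add_distrib, ← Finset.sum_add_distrib]
    refine Finset.sum_congr rfl fun j _ => ?_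
    rcases lt_trichotomy (i : ℕ) (j : ℕ) with h | h | h
    · simp [h, h.not_gt, show i ≠ j by rintro rfl; exact lt_irrefl _ h]
    · obtain rfl := Fin.ext h
      simp
    · simp [h, h.not_gt, show i ≠ j by rintro rfl; exact lt_irrefl _ h, mul_comm]
  rw [h2, ← h1, Finset.sum_add_distrib, ← Finset.mul_sum]
  simp only [Finset.sum_mul, ite_mul, zero_mul]
  ring

/-! ### The linearization error: its norm and its ranks. -/

section Estimates

variable {N : ℕ} {d : Fin N → ℕ} {r : Fin (N + 1) → ℕ}

theorem sv_le_sigmaMax (X : Tensor d) (k : Bond N) : sv X k 1 ≤ sigmaMax X :=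
  le_ciSup (f := fun k : Bond N => sv X k 1) (Set.finite_range _).bddAbove k

theorem sigmaMin_le_sv (X : Tensor d) (k : Bond N) : sigmaMin X ≤ sv X k (ttRank X k) :=
  ciInf_le (f := fun k : Bond N => sv X k (ttRank X k)) (Set.finite_range _).bddBelow k

theorem opLe_cut (X : Tensor d) (k : Bond N) : OpLe (cut X k.1) (sigmaMax X) :=
  (opLe_singularValues_zero (cut X k.1)).mono (sv_le_sigmaMax X k)

theorem sv_pos (X : Tensor d) (k : Bond N) (h : 1 ≤ ttRank X k) : 0 < sv X k (ttRank X k) := by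
  have hrank : Module.finrank ℝ (LinearMap.range (unfolding X k).toEuclideanLin) =
      (unfolding X k).rank := by
    rw [(unfolding X k).rank_eq_finrank_range_toLin (EuclideanSpace.basisFun _ ℝ).toBasis
      (EuclideanSpace.basisFun _ ℝ).toBasis]
    rfl
  rw [sv, LinearMap.singularValues_pos_iff_lt_finrank_range, hrank]
  -- Positive rank is needed here: the singular value is taken at the zero-based index `rank - 1`.
  exact Nat.sub_lt (Nat.lt_of_lt_of_le zero_lt_one h) zero_lt_one

theorem nonempty_bond (hN2 : 2 ≤ N) : Nonempty (Bond N) :=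
  ⟨⟨⟨1, by omega⟩, by simp, by simp; omega⟩⟩

theorem sigmaMin_pos (hN2 : 2 ≤ N) (X : Tensor d) (h : ∀ k, 1 ≤ ttRank X k) :
    0 < sigmaMin X := by
  have := nonempty_bond hN2
  obtain ⟨k, hk⟩ := exists_eq_ciInf_of_finite (f := fun k : Bond N => sv X k (ttRank X k))
  rw [sigmaMin, ← hk]
  exact sv_pos X k (h k)

theorem sigmaMin_le_sigmaMax (hN2 : 2 ≤ N) (X : Tensor d) : sigmaMin X ≤ sigmaMax X := by
  obtain ⟨k⟩ := nonempty_bond hN2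
  refine (sigmaMin_le_sv X k).trans (le_trans ?_ (sv_le_sigmaMax X k))
  exact LinearMap.singularValues_antitone _ (by simp)

variable (h0 : r 0 = 1) (hN : r (Fin.last N) = 1) (s₀ : (i : Fin N) → Fin (d i))

/-- The left part is an isometry, so the right part is its transpose times the unfolding. -/
theorem opLe_rightMat {X : Factors d r} (hX : LeftOrthogonal X) (k : Fin (N + 1))
    (hk : (k : ℕ) < N) {c : ℝ} (h : OpLe (cut (ttTensor h0 hN X) k) c) :
    OpLe (rightMat hN s₀ X k) c := by
  have hiso := leftMat_isometry h0 s₀ hX k hk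
  have h1 : rightMat hN s₀ X k = (leftMat h0 s₀ X k)ᵀ * cut (ttTensor h0 hN X) k := by
    rw [cut_ttTensor h0 hN s₀, ← Matrix.mul_assoc, hiso, Matrix.one_mul]
  rw [h1]
  simpa using ((opLe_of_isometry hiso).transpose zero_le_one).mul zero_le_one h

theorem leftMat_succ_sub (U V : Factors d r) (i : Fin N) :
    leftMat h0 s₀ U i.succ - leftMat h0 s₀ V i.succ =
      stepMat (leftMat h0 s₀ U i.castSucc - leftMat h0 s₀ V i.castSucc) (U i) +
        stepMat (leftMat h0 s₀ V i.castSucc) (U i - V i) := by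
  rw [leftMat_succ, leftMat_succ, stepMat_sub_left, stepMat_sub_right]
  abel

theorem leftUnfold_sub {n p q : ℕ} (Y Z : Fin n → Matrix (Fin p) (Fin q) ℝ) :
    leftUnfold (Y - Z) = leftUnfold Y - leftUnfold Z := rfl

/-- Factors are exchanged one at a time; all the others form isometries, so each exchange costs only
the norm of its factor difference. -/
theorem opLe_leftMat_sub {U V : Factors d r} (hU : LeftOrthogonal U) (hV : LeftOrthogonal V)
    (k : Fin (N + 1)) (hk : (k : ℕ) < N) :
    OpLe (leftMat h0 s₀ U k - leftMat h0 s₀ V k)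
      (∑ j : Fin N, if (j : ℕ) < (k : ℕ) then frobNorm (leftUnfold (U j - V j)) else 0) := by
  induction k using Fin.induction with
  | zero =>
    rw [leftMat_zero h0 s₀ U V, sub_self]
    intro v
    simp [vecNorm]
  | succ i ih =>
    have hi : (i.castSucc : ℕ) < N := by simp
    have h1 : ∑ j : Fin N,
          (if (j : ℕ) < (i.succ : ℕ) then frobNorm (leftUnfold (U j - V j)) else 0) =
        (∑ j : Fin N, if (j : ℕ) < (i.castSucc : ℕ) then frobNorm (leftUnfold (U j - V j)) else 0) +
          frobNorm (leftUnfold (U i - V i)) := by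
      have h2 : frobNorm (leftUnfold (U i - V i)) =
          ∑ j : Fin N, if i = j then frobNorm (leftUnfold (U j - V j)) else 0 := by simp
      conv_rhs => rw [h2]
      rw [← Finset.sum_add_distrib]
      refine Finset.sum_congr rfl fun j _ => ?_
      rcases lt_trichotomy (i : ℕ) (j : ℕ) with h | h | h
      · rw [if_neg (by simp; omega), if_neg (by simp; omega), if_neg (by rintro rfl; omega)]
        simp
      · obtain rfl := Fin.ext h
        simp
      · rw [if_pos (by simp; omega), if_pos (by simpa using h), if_neg (by rintro rfl; omega)]
        simp
    rw [leftMat_succ_sub, h1]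
    refine OpLe.add ?_ ?_
    · have := opLe_stepMat
        (Finset.sum_nonneg fun j _ => by split_ifs; exacts [frobNorm_nonneg _, le_rfl])
        (ih hi) (opLe_of_isometry (hU i (by simpa using hk)))
      rwa [mul_one] at this
    · have := opLe_stepMat zero_le_one (opLe_of_isometry (leftMat_isometry h0 s₀ hV i.castSucc hi))
        (opLe_frobNorm (leftUnfold (U i - V i)))
      rwa [one_mul] at this

/-- The factor whose left unfolding is `M`. -/
def foldLeft {n p q : ℕ} (M : Matrix (Fin n × Fin p) (Fin q) ℝ) :
    Fin n → Matrix (Fin p) (Fin q) ℝ :=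
  fun t => Matrix.of fun a b => M (t, a) b

theorem leftUnfold_foldLeft {n p q : ℕ} (M : Matrix (Fin n × Fin p) (Fin q) ℝ) :
    leftUnfold (foldLeft M) = M := rfl

/-- The difference of the factors of `U` and `V`, projected onto the tangent space at `U`. -/
def tangentDiff (U V : Factors d r) : Factors d r := fun i =>
  if (i : ℕ) + 1 < N then foldLeft (tangentProj (leftUnfold (U i)) (leftUnfold (U i - V i)))
  else U i - V i

/-- Both tensors share the factors of `U` after `i`. What remains is the change of the left part,
applied to `U i - V i`, and the correction `Y`. -/
theorem norm_sandwich_sub_le {U V : Factors d r} (hU : LeftOrthogonal U) (hV : LeftOrthogonal V)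
    (i : Fin N) (Y : Fin (d i) → Matrix (Fin (r i.castSucc)) (Fin (r i.succ)) ℝ) {c : ℝ}
    (hc : 0 ≤ c) (h : OpLe (rightMat hN s₀ U i.succ) c) :
    ‖sandwich h0 hN U i (U i - V i - Y) U - sandwich h0 hN V i (U i - V i) U‖ ≤
      ((∑ j : Fin N, if (j : ℕ) < (i : ℕ) then frobNorm (leftUnfold (U j - V j)) else 0) *
        frobNorm (leftUnfold (U i - V i)) + frobNorm (leftUnfold Y)) * c := by
  have hi : (i.castSucc : ℕ) < N := by simp
  rw [← frobNorm_cut _ i.succ, cut_sub, cut_sandwich h0 hN s₀, cut_sandwich h0 hN s₀,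
    ← Matrix.sub_mul]
  refine (h.frobNorm_mul_le' hc _).trans (mul_le_mul_of_nonneg_right ?_ hc)
  have h1 : stepMat (leftMat h0 s₀ U i.castSucc) (U i - V i - Y) -
      stepMat (leftMat h0 s₀ V i.castSucc) (U i - V i) =
      stepMat (leftMat h0 s₀ U i.castSucc - leftMat h0 s₀ V i.castSucc) (U i - V i) -
        stepMat (leftMat h0 s₀ U i.castSucc) Y := by
    rw [stepMat_sub_right, stepMat_sub_left]
    abel
  rw [h1]
  refine (frobNorm_sub_le _ _).trans (add_le_add ?_ ?_)
  · exact frobNorm_stepMat_le (Finset.sum_nonneg fun j _ => by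
      split_ifs; exacts [frobNorm_nonneg _, le_rfl]) (opLe_leftMat_sub h0 s₀ hU hV i.castSucc hi)
  · rw [frobNorm_stepMat_of_isometry (leftMat_isometry h0 s₀ hU i.castSucc hi)]

/-- The error of the linearization in the projected differences of the factors is quadratic in the
distance of the factors. -/
theorem ttTensor_linearization_le (s₀ : (i : Fin N) → Fin (d i)) {U V : Factors d r}
    (hU : LeftOrthogonal U) (hV : LeftOrthogonal V) {σ : ℝ} (hσ : 0 < σ)
    (h : ∀ k : Bond N, OpLe (cut (ttTensor h0 hN U) k.1) (3 / 2 * σ)) :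
    ‖∑ i, sandwich h0 hN U i (tangentDiff U V i) U - (ttTensor h0 hN U - ttTensor h0 hN V)‖ ≤
      3 * N / (4 * σ) * ∑ i : Fin N, (if (i : ℕ) + 1 < N then σ ^ 2 else 1) *
        frobSq (leftUnfold (U i) - leftUnfold (V i)) := by
  set D : Fin N → ℝ := fun i => frobNorm (leftUnfold (U i - V i)) with hD
  -- These weights make `∑ t i ^ 2` the squared factor distance.
  set t : Fin N → ℝ := fun i => (if (i : ℕ) + 1 < N then σ else 1) * D i with ht
  have hD0 : ∀ i, 0 ≤ D i := fun i => frobNorm_nonneg _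
  have ht0 : ∀ i, 0 ≤ t i := fun i => mul_nonneg (by split_ifs <;> positivity) (hD0 i)
  have hsum : ∀ i : Fin N, (∑ j : Fin N, if (j : ℕ) < (i : ℕ) then t j else 0) =
      σ * ∑ j : Fin N, if (j : ℕ) < (i : ℕ) then D j else 0 := by
    intro i
    rw [Finset.mul_sum]
    refine Finset.sum_congr rfl fun j _ => ?_
    split_ifs with hj
    · simp only [ht]
      rw [if_pos (by omega)]
    · simp
  have hterm : ∀ i, ‖sandwich h0 hN U i (tangentDiff U V i) U -
      sandwich h0 hN V i (U i - V i) U‖ ≤ 3 / (2 * σ) *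
        ((∑ j : Fin N, if (j : ℕ) < (i : ℕ) then t j else 0) * t i + 1 / 2 * t i ^ 2) := by
    intro i
    rw [hsum]
    have hS : 0 ≤ ∑ j : Fin N, if (j : ℕ) < (i : ℕ) then D j else 0 :=
      Finset.sum_nonneg fun j _ => by split_ifs; exacts [hD0 j, le_rfl]
    by_cases hi : (i : ℕ) + 1 < N
    · have hti : t i = σ * D i := by simp [ht, hi]
      have hR : OpLe (rightMat hN s₀ U i.succ) (3 / 2 * σ) :=
        opLe_rightMat h0 hN s₀ hU i.succ (by simpa using hi)
          (h ⟨i.succ, by simp, by simpa using hi⟩)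
      -- The normal component removed by the projection, of norm at most `D i ^ 2 / 2`.
      set Y := foldLeft ((1 / 2 : ℝ) • (leftUnfold (U i) *
        ((leftUnfold (U i - V i))ᵀ * leftUnfold (U i - V i)))) with hY
      have hdiff : tangentDiff U V i = U i - V i - Y := by
        rw [tangentDiff, if_pos hi, leftUnfold_sub, tangentProj_sub_of_isometry (hU i hi) (hV i hi)]
        rfl
      have hYn : frobNorm (leftUnfold Y) ≤ 1 / 2 * D i ^ 2 := by
        rw [hY, leftUnfold_foldLeft, frobNorm_smul, abs_of_pos (by norm_num),
          frobNorm_mul_of_isometry (hU i hi)]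
        refine mul_le_mul_of_nonneg_left ?_ (by norm_num)
        rw [sq]
        refine ((opLe_frobNorm _).frobNorm_mul_le (frobNorm_nonneg _) _).trans_eq ?_
        rw [frobNorm_transpose]
      rw [hdiff, hti]
      refine (norm_sandwich_sub_le h0 hN s₀ hU hV i Y (by positivity) hR).trans ?_
      calc _ ≤ ((∑ j : Fin N, if (j : ℕ) < (i : ℕ) then D j else 0) * D i + 1 / 2 * D i ^ 2) *
            (3 / 2 * σ) := by gcongr
        _ = _ := by field_simp
    · have hti : t i = D i := by simp [ht, hi]
      have hl : i.succ = Fin.last N := Fin.ext (by simp; omega)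
      have hR : OpLe (rightMat hN s₀ U i.succ) 1 := by
        rw [hl]
        have := opLe_of_isometry (M := (rightMat hN s₀ U (Fin.last N))ᵀ)
          (by rw [transpose_transpose]; exact rightMat_last_isometry hN s₀ U)
        simpa using this.transpose zero_le_one
      have hdiff : tangentDiff U V i = U i - V i - 0 := by rw [tangentDiff, if_neg hi, sub_zero]
      have h00 : frobNorm (leftUnfold
          (0 : Fin (d i) → Matrix (Fin (r i.castSucc)) (Fin (r i.succ)) ℝ)) = 0 := by
        have : leftUnfold (0 : Fin (d i) → Matrix (Fin (r i.castSucc)) (Fin (r i.succ)) ℝ) =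
          (0 : ℝ) • 0 := by rw [zero_smul]; rfl
        rw [this, frobNorm_smul, abs_zero, zero_mul]
      rw [hdiff, hti]
      refine (norm_sandwich_sub_le h0 hN s₀ hU hV i 0 zero_le_one hR).trans ?_
      rw [h00, add_zero, mul_one]
      -- The unprojected last factor has no quadratic correction; the bound is weakened to the
      -- common shape so that all terms add up to half of `(∑ t i) ^ 2`.
      calc (∑ j : Fin N, if (j : ℕ) < (i : ℕ) then D j else 0) * D i
          ≤ 3 / 2 * ((∑ j : Fin N, if (j : ℕ) < (i : ℕ) then D j else 0) * D i) +
            3 / (4 * σ) * D i ^ 2 := by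
            have := mul_nonneg hS (hD0 i)
            have : 0 ≤ 3 / (4 * σ) * D i ^ 2 := by positivity
            linarith
        _ = _ := by field_simp; ring
  have hZ : ∑ i, sandwich h0 hN U i (tangentDiff U V i) U -
      (ttTensor h0 hN U - ttTensor h0 hN V) = ∑ i, (sandwich h0 hN U i (tangentDiff U V i) U -
        sandwich h0 hN V i (U i - V i) U) := by
    rw [ttTensor_sub_ttTensor, Finset.sum_sub_distrib]
  have hsq : ∀ i : Fin N, (if (i : ℕ) + 1 < N then σ ^ 2 else 1) *
      frobSq (leftUnfold (U i) - leftUnfold (V i)) = t i ^ 2 := by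
    intro i
    rw [← leftUnfold_sub, ← frobNorm_sq]
    simp only [ht, hD, mul_pow]
    split_ifs <;> simp
  rw [hZ]
  refine (norm_sum_le _ _).trans ((Finset.sum_le_sum fun i _ => hterm i).trans ?_)
  rw [← Finset.mul_sum, sum_mul_sum_lt_add_half_sq, Finset.sum_congr rfl fun i _ => hsq i]
  have hcs : (∑ i, t i) ^ 2 ≤ N * ∑ i, t i ^ 2 := by
    simpa using sq_sum_le_card_mul_sum_sq (s := Finset.univ) (f := t)
  calc 3 / (2 * σ) * (1 / 2 * (∑ i, t i) ^ 2) ≤ 3 / (2 * σ) * (1 / 2 * (N * ∑ i, t i ^ 2)) := by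
        gcongr
    _ = _ := by field_simp; ring

/-- The linearization error of the TT format has unfoldings of at most three times the rank. -/
theorem rank_cut_linearization_le (s₀ : (i : Fin N) → Fin (d i)) (U V Y : Factors d r)
    (k : Fin (N + 1)) :
    (cut (∑ i, sandwich h0 hN U i (Y i) U - (ttTensor h0 hN U - ttTensor h0 hN V)) k).rank ≤
      3 * r k := by
  -- Terms modified after the cut share the left part of `U`, terms modified before it share the
  -- right part, so the whole sum is two products.
  have hsplit : cut (∑ i, sandwich h0 hN U i (Y i) U) k =
      leftMat h0 s₀ U k * (∑ i ∈ Finset.univ.filter fun i : Fin N => ¬ (i : ℕ) < (k : ℕ),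
        rightMat hN s₀ (Function.update U i (Y i)) k) +
      (∑ i ∈ Finset.univ.filter fun i : Fin N => (i : ℕ) < (k : ℕ),
        leftMat h0 s₀ (Function.update U i (Y i)) k) * rightMat hN s₀ U k := by
    rw [cut_sum, ← Finset.sum_filter_add_sum_filter_not _ fun i : Fin N => (i : ℕ) < (k : ℕ),
      Matrix.mul_sum, Matrix.sum_mul]
    refine (add_comm _ _).trans (congrArg₂ _ ?_ ?_)
    · refine Finset.sum_congr rfl fun i hi => ?_
      have hi := (Finset.mem_filter.mp hi).2
      rw [sandwich_self, cut_ttTensor h0 hN s₀,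
        leftMat_congr (X := Function.update U i (Y i)) (Y := U) h0 s₀ k fun j hj => by
          rw [Function.update_of_ne (by rintro rfl; exact hi hj)]]
    · refine Finset.sum_congr rfl fun i hi => ?_
      have hi := (Finset.mem_filter.mp hi).2
      rw [sandwich_self, cut_ttTensor h0 hN s₀,
        rightMat_congr (X := Function.update U i (Y i)) (Y := U) hN s₀ k fun j hj => by
          rw [Function.update_of_ne (by rintro rfl; exact hj hi)]]
  -- The tensor of `U` is absorbed into the first product, so three products remain rather than
  -- four.
  have h1 : cut (∑ i, sandwich h0 hN U i (Y i) U - (ttTensor h0 hN U - ttTensor h0 hN V)) k =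
      leftMat h0 s₀ U k * ((∑ i ∈ Finset.univ.filter fun i : Fin N => ¬ (i : ℕ) < (k : ℕ),
        rightMat hN s₀ (Function.update U i (Y i)) k) - rightMat hN s₀ U k) +
      (∑ i ∈ Finset.univ.filter fun i : Fin N => (i : ℕ) < (k : ℕ),
        leftMat h0 s₀ (Function.update U i (Y i)) k) * rightMat hN s₀ U k +
      leftMat h0 s₀ V k * rightMat hN s₀ V k := by
    rw [cut_sub, hsplit, cut_sub, cut_ttTensor h0 hN s₀, cut_ttTensor h0 hN s₀, Matrix.mul_sub]
    abel
  rw [h1]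
  refine (rank_add_le _ _).trans ((add_le_add ((rank_add_le _ _).trans
    (add_le_add (rank_mul_le_card _ _) (rank_mul_le_card _ _))) (rank_mul_le_card _ _)).trans_eq ?_)
  ring

theorem sum_frobInner_riemSubgrad {m : ℕ} (A : Fin m → Tensor d) (y : Fin m → ℝ)
    (U V : Factors d r) :
    ∑ i, frobInner (leftUnfold (U i) - leftUnfold (V i)) (riemSubgrad h0 hN A y U i) =
      1 / (m : ℝ) * ∑ k, Real.sign (inner ℝ (A k) (ttTensor h0 hN U) - y k) *
        inner ℝ (A k) (∑ i, sandwich h0 hN U i (tangentDiff U V i) U) := by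
  have h : ∀ i, frobInner (leftUnfold (U i) - leftUnfold (V i)) (riemSubgrad h0 hN A y U i) =
      frobInner (leftUnfold (tangentDiff U V i)) (leftUnfold (subgrad h0 hN A y U i)) := by
    intro i
    rw [riemSubgrad, tangentDiff]
    split_ifs
    · rw [frobInner_tangentProj, leftUnfold_foldLeft, leftUnfold_sub]
    · rw [leftUnfold_sub]
  simp only [h, frobInner_subgrad, inner_sum, Finset.mul_sum]
  exact Finset.sum_comm

end Estimates

/-! ### Bounding the factor distance by the tensor distance. -/

section Distance

variable {N : ℕ} {d : Fin N → ℕ} {r : Fin (N + 1) → ℕ}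

/-- The left singular subspaces of two tensors are aligned up to the distance of the tensors over
the smallest singular value. -/
theorem exists_orthogonal_leftMat_sub_le (h0 : r 0 = 1) (hN : r (Fin.last N) = 1)
    (s₀ : (i : Fin N) → Fin (d i)) {U V : Factors d r}
    (hU : LeftOrthogonal U) (hV : LeftOrthogonal V) (k : Bond N)
    (hrank : ttRank (ttTensor h0 hN V) k = r k.1) (hpos : 0 ≤ sigmaMin (ttTensor h0 hN V)) :
    ∃ R ∈ orthogonalGroup (Fin (r k.1)) ℝ, sigmaMin (ttTensor h0 hN V) ^ 2 *
      frobNorm (leftMat h0 s₀ U k.1 - leftMat h0 s₀ V k.1 * R) ^ 2 ≤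
        2 * ‖ttTensor h0 hN U - ttTensor h0 hN V‖ ^ 2 := by
  have hUi := leftMat_isometry h0 s₀ hU k.1 k.2.2
  have hVi := leftMat_isometry h0 s₀ hV k.1 k.2.2
  obtain ⟨R, hR, h⟩ := exists_orthogonal_frobNorm_sub_le hUi hVi
  refine ⟨R, hR, ?_⟩
  set P := leftMat h0 s₀ U k.1
  set Y := leftMat h0 s₀ V k.1 - P * (Pᵀ * leftMat h0 s₀ V k.1) with hY
  have hVc := cut_ttTensor h0 hN s₀ V k.1
  have hUc := cut_ttTensor h0 hN s₀ U k.1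
  have h1 : sigmaMin (ttTensor h0 hN V) * frobNorm Y ≤
      frobNorm (Y * rightMat hN s₀ V k.1) := by
    have h2 := sigmaMin_le_sv (ttTensor h0 hN V) k
    rw [sv, ttRank, unfolding_eq_cut, hVc] at h2
    refine (mul_le_mul_of_nonneg_right h2 (frobNorm_nonneg _)).trans ?_
    refine singularValues_mul_frobNorm_le hVi ?_ Y
    rw [← hVc, Fintype.card_fin]
    exact hrank
  -- The projection off the range of `P` annihilates the unfolding of the tensor of `U`, which may
  -- therefore be subtracted at no cost.
  have h3 : Y * rightMat hN s₀ V k.1 =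
      -(cut (ttTensor h0 hN U - ttTensor h0 hN V) k.1 -
        P * (Pᵀ * cut (ttTensor h0 hN U - ttTensor h0 hN V) k.1)) := by
    rw [cut_sub, hUc, hVc, hY, Matrix.mul_sub, Matrix.mul_sub, Matrix.sub_mul,
      ← Matrix.mul_assoc Pᵀ P, hUi, Matrix.one_mul]
    simp only [Matrix.mul_assoc]
    abel
  have h4 : frobNorm (Y * rightMat hN s₀ V k.1) ^ 2 ≤
      ‖ttTensor h0 hN U - ttTensor h0 hN V‖ ^ 2 := by
    rw [h3, ← neg_one_smul ℝ, frobNorm_smul, abs_neg, abs_one, one_mul,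
      frobNorm_sq_sub_mul_transpose_mul hUi, frobNorm_cut]
    linarith [sq_nonneg (frobNorm (Pᵀ * cut (ttTensor h0 hN U - ttTensor h0 hN V) k.1))]
  have h5 := pow_le_pow_left₀ (mul_nonneg hpos (frobNorm_nonneg Y)) h1 2
  rw [mul_pow] at h5
  have h6 := mul_le_mul_of_nonneg_left h (sq_nonneg (sigmaMin (ttTensor h0 hN V)))
  linarith

/-- The alignments at different bonds do not interact, so they are chosen separately, with the
identity at both ends. -/
theorem exists_rotations_leftMat_sub_le (h0 : r 0 = 1) (hN : r (Fin.last N) = 1)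
    (s₀ : (i : Fin N) → Fin (d i)) {U V : Factors d r}
    (hU : LeftOrthogonal U) (hV : LeftOrthogonal V)
    (hrank : ∀ k : Bond N, ttRank (ttTensor h0 hN V) k = r k.1)
    (hpos : 0 ≤ sigmaMin (ttTensor h0 hN V)) :
    ∃ R ∈ Rotations r, ∀ k : Fin (N + 1), (k : ℕ) < N → sigmaMin (ttTensor h0 hN V) ^ 2 *
      frobNorm (leftMat h0 s₀ U k - leftMat h0 s₀ (rotate R V) k) ^ 2 ≤
        2 * ‖ttTensor h0 hN U - ttTensor h0 hN V‖ ^ 2 := by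
  have h : ∀ k : Fin (N + 1), ∃ R ∈ orthogonalGroup (Fin (r k)) ℝ,
      (k = 0 → R = 1) ∧ (k = Fin.last N → R = 1) ∧ ((k : ℕ) < N →
        sigmaMin (ttTensor h0 hN V) ^ 2 *
          frobNorm (leftMat h0 s₀ U k - leftMat h0 s₀ V k * R) ^ 2 ≤
            2 * ‖ttTensor h0 hN U - ttTensor h0 hN V‖ ^ 2) := by
    intro k
    by_cases hk0 : k = 0
    · subst hk0
      refine ⟨1, one_mem _, fun _ => rfl, fun _ => rfl, fun _ => ?_⟩
      have h00 : frobNorm (0 : Matrix (LeftIdx d 0) (Fin (r 0)) ℝ) = 0 := by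
        rw [← zero_smul ℝ (0 : Matrix (LeftIdx d 0) (Fin (r 0)) ℝ), frobNorm_smul, abs_zero,
          zero_mul]
      rw [Matrix.mul_one, leftMat_zero h0 s₀ U V, sub_self, h00, zero_pow two_ne_zero, mul_zero]
      positivity
    by_cases hkN : k = Fin.last N
    · subst hkN
      exact ⟨1, one_mem _, fun _ => rfl, fun _ => rfl, fun h => absurd h (by simp)⟩
    · have hk : 0 < (k : ℕ) ∧ (k : ℕ) < N := by
        refine ⟨Nat.pos_of_ne_zero fun h => hk0 (Fin.ext h), lt_of_le_of_ne (by omega) fun h =>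
          hkN (Fin.ext h)⟩
      obtain ⟨R, hR, hb⟩ := exists_orthogonal_leftMat_sub_le h0 hN s₀ hU hV ⟨k, hk⟩ (hrank _) hpos
      exact ⟨R, hR, fun h => absurd h hk0, fun h => absurd h hkN, fun _ => hb⟩
  choose R hR hR0 hRN hb using h
  have hmem : R ∈ Rotations r := ⟨hR, hR0 0 rfl, hRN _ rfl⟩
  refine ⟨R, hmem, fun k hk => ?_⟩
  rw [leftMat_rotate h0 s₀ hmem]
  exact hb k hk

/-- Multiplying the factor difference by the isometric left part of `U` expresses it through the
partial products before and after it. -/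
theorem frobNorm_leftUnfold_sub_le (h0 : r 0 = 1) (s₀ : (i : Fin N) → Fin (d i))
    {U : Factors d r} (hU : LeftOrthogonal U) (V : Factors d r) (i : Fin N) :
    frobNorm (leftUnfold (U i - V i)) ≤
      frobNorm (leftMat h0 s₀ U i.succ - leftMat h0 s₀ V i.succ) +
        frobNorm (leftMat h0 s₀ U i.castSucc - leftMat h0 s₀ V i.castSucc) *
          frobNorm (leftUnfold (V i)) := by
  rw [← frobNorm_stepMat_of_isometry (leftMat_isometry h0 s₀ hU i.castSucc (by simp))]
  have h : stepMat (leftMat h0 s₀ U i.castSucc) (U i - V i) =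
      (leftMat h0 s₀ U i.succ - leftMat h0 s₀ V i.succ) -
        stepMat (leftMat h0 s₀ U i.castSucc - leftMat h0 s₀ V i.castSucc) (V i) := by
    rw [leftMat_succ, leftMat_succ, stepMat_sub_left, stepMat_sub_right]
    abel
  rw [h]
  exact (frobNorm_sub_le _ _).trans (add_le_add_right
    (frobNorm_stepMat_le (frobNorm_nonneg _) (opLe_frobNorm _)) _)

/-- At the last factor the partial product is the tensor itself. The Frobenius norm falls on the
difference of the left parts, and the remaining factor of `V` needs only a spectral bound. -/
theorem frobNorm_leftUnfold_sub_le_of_last (h0 : r 0 = 1) (hN : r (Fin.last N) = 1)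
    (s₀ : (i : Fin N) → Fin (d i)) {U V : Factors d r} (hU : LeftOrthogonal U) (i : Fin N)
    (hi : ¬ (i : ℕ) + 1 < N) {c : ℝ} (hc : 0 ≤ c) (h : OpLe (rightMat hN s₀ V i.castSucc) c) :
    frobNorm (leftUnfold (U i - V i)) ≤ ‖ttTensor h0 hN U - ttTensor h0 hN V‖ +
      frobNorm (leftMat h0 s₀ U i.castSucc - leftMat h0 s₀ V i.castSucc) * c := by
  have hl : i.succ = Fin.last N := Fin.ext (by simp; omega)
  have h1 : frobNorm (leftUnfold (U i - V i)) = ‖sandwich h0 hN U i (U i - V i) V‖ := by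
    -- Stated for a variable `k` because the matrix types depend on the index being replaced.
    have h2 : ∀ k, k = Fin.last N → ∀ M : Matrix (LeftIdx d k) (Fin (r k)) ℝ,
        frobNorm (M * rightMat hN s₀ V k) = frobNorm M := by
      rintro k rfl M
      exact frobNorm_mul_rightMat_last hN s₀ V M
    rw [← frobNorm_cut _ i.succ, cut_sandwich h0 hN s₀, h2 _ hl,
      frobNorm_stepMat_of_isometry (leftMat_isometry h0 s₀ hU i.castSucc (by simp))]
  have h3 : sandwich h0 hN U i (U i - V i) V = (ttTensor h0 hN U - ttTensor h0 hN V) -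
      (glue h0 hN U V i.castSucc - glue h0 hN V V i.castSucc) := by
    rw [sandwich_sub, ← glue_succ, ← glue_castSucc, hl, glue_last, glue_self]
    abel
  rw [h1, h3]
  refine (norm_sub_le _ _).trans (add_le_add_right ?_ _)
  rw [← frobNorm_cut _ i.castSucc, cut_sub, cut_glue h0 hN s₀, cut_glue h0 hN s₀,
    ← Matrix.sub_mul]
  exact h.frobNorm_mul_le' hc _

/-- The ranks `r_2, …, r_{N-1}` are those after the factors that are neither first nor last; the
bound has a slack of one. -/
theorem sum_add_one_le_rankSum (r : Fin (N + 1) → ℕ) :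
    ∑ i : Fin N, (1 + if 1 ≤ (i : ℕ) ∧ (i : ℕ) + 1 < N then (r i.succ : ℝ) else 0) ≤
      rankSum r := by
  rw [rankSum, Finset.sum_filter, Fin.sum_univ_succ, Finset.sum_add_distrib]
  simp

/-- The factors are close up to rotations if the tensors are close. -/
theorem exists_rotations_rotDistSq_le (hN2 : 2 ≤ N) (h0 : r 0 = 1) (hN : r (Fin.last N) = 1)
    (s₀ : (i : Fin N) → Fin (d i)) {U V : Factors d r}
    (hU : LeftOrthogonal U) (hV : LeftOrthogonal V)
    (hrank : ∀ k : Bond N, ttRank (ttTensor h0 hN V) k = r k.1)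
    (hpos : 0 < sigmaMin (ttTensor h0 hN V)) :
    ∃ R ∈ Rotations r, rotDistSq (sigmaMax (ttTensor h0 hN V)) U V R ≤
      8 * rankSum r * kappa (ttTensor h0 hN V) ^ 2 *
        ‖ttTensor h0 hN U - ttTensor h0 hN V‖ ^ 2 := by
  obtain ⟨R, hR, hb⟩ := exists_rotations_leftMat_sub_le h0 hN s₀ hU hV hrank hpos.le
  refine ⟨R, hR, ?_⟩
  have hτσ := sigmaMin_le_sigmaMax hN2 (ttTensor h0 hN V)
  have hW := leftOrthogonal_rotate hR hV
  have hWt := ttTensor_rotate h0 hN hR V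
  have hop : ∀ k : Bond N, OpLe (cut (ttTensor h0 hN V) k.1) (sigmaMax (ttTensor h0 hN V)) :=
    fun k => opLe_cut _ k
  rw [kappa]
  set τ := sigmaMin (ttTensor h0 hN V)
  set σ := sigmaMax (ttTensor h0 hN V)
  have hσ : 0 < σ := hpos.trans_le hτσ
  rw [← hWt] at hb ⊢
  set W := rotate R V with hWdef
  set e := ‖ttTensor h0 hN U - ttTensor h0 hN W‖
  set q := e ^ 2 / τ ^ 2 with hq
  have hq0 : 0 ≤ q := by positivity
  have hε : ∀ k : Fin (N + 1), (k : ℕ) < N →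
      frobNorm (leftMat h0 s₀ U k - leftMat h0 s₀ W k) ^ 2 ≤ 2 * q := by
    intro k hk
    have := hb k hk
    rw [hq, ← mul_div_assoc, le_div_iff₀ (by positivity)]
    linarith
  -- A middle factor contributes `1 + r_i` since its squared Frobenius norm is `r_i`. The first has
  -- no rank term because the empty products agree, nor does the last, where the spectral norm is
  -- used. The constant 8 covers 4, 2 and 6 respectively.
  have hterm : ∀ i : Fin N, (if (i : ℕ) + 1 < N then σ ^ 2 else 1) *
      frobSq (leftUnfold (U i) - leftUnfold (W i)) ≤
      8 * (q * σ ^ 2) * (1 + if 1 ≤ (i : ℕ) ∧ (i : ℕ) + 1 < N then (r i.succ : ℝ) else 0) := by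
    intro i
    rw [← leftUnfold_sub, ← frobNorm_sq]
    have hD0 := frobNorm_nonneg (leftUnfold (U i - W i))
    have hA := hε i.castSucc (by simp)
    by_cases hi : (i : ℕ) + 1 < N
    · have h1 := frobNorm_leftUnfold_sub_le h0 s₀ hU W i
      have h2 := frobNorm_sq_of_isometry (hW i hi)
      have hB := hε i.succ (by simpa using hi)
      rw [Fintype.card_fin] at h2
      rw [if_pos hi]
      have hr0 : (0 : ℝ) ≤ r i.succ := Nat.cast_nonneg _
      by_cases hi1 : 1 ≤ (i : ℕ)
      · rw [if_pos ⟨hi1, hi⟩]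
        have h3 : frobNorm (leftUnfold (U i - W i)) ^ 2 ≤ 2 * (2 * q) + 2 * (2 * q * r i.succ) := by
          refine (pow_le_pow_left₀ hD0 h1 2).trans (add_sq_le.trans ?_)
          rw [mul_pow, h2]
          have := mul_le_mul_of_nonneg_right hA hr0
          linarith
        calc σ ^ 2 * frobNorm (leftUnfold (U i - W i)) ^ 2
            ≤ σ ^ 2 * (2 * (2 * q) + 2 * (2 * q * r i.succ)) := by gcongr
          _ ≤ _ := by
            have : 0 ≤ σ ^ 2 * q * (1 + r i.succ) := by positivity
            linarith
      · rw [if_neg (by tauto)]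
        have hi0 : i.castSucc = 0 := Fin.ext (by simp; omega)
        have h00 : frobNorm (leftMat h0 s₀ U i.castSucc - leftMat h0 s₀ W i.castSucc) = 0 := by
          have : ∀ k : Fin (N + 1), k = 0 → leftMat h0 s₀ U k = leftMat h0 s₀ W k := by
            rintro k rfl
            exact leftMat_zero h0 s₀ U W
          rw [this _ hi0, sub_self]
          rw [← zero_smul ℝ (0 : Matrix _ _ ℝ), frobNorm_smul, abs_zero, zero_mul]
        rw [h00, zero_mul, add_zero] at h1
        have h3 := (pow_le_pow_left₀ hD0 h1 2).trans hB
        have := mul_le_mul_of_nonneg_left h3 (sq_nonneg σ)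
        have : 0 ≤ σ ^ 2 * q := by positivity
        linarith
    · rw [if_neg hi, if_neg (by tauto), one_mul, add_zero, mul_one]
      have hR' : OpLe (rightMat hN s₀ W i.castSucc) σ := by
        refine opLe_rightMat h0 hN s₀ hW i.castSucc (by simp) ?_
        rw [hWt]
        exact hop ⟨i.castSucc, by simp; omega, by simp⟩
      have h1 := frobNorm_leftUnfold_sub_le_of_last h0 hN s₀ hU i hi hσ.le hR'
      have h2 : e ^ 2 ≤ q * σ ^ 2 := by
        have : e ^ 2 = q * τ ^ 2 := by rw [hq]; field_simp
        rw [this]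
        gcongr
      refine (pow_le_pow_left₀ hD0 h1 2).trans (add_sq_le.trans ?_)
      rw [mul_pow]
      have := mul_le_mul_of_nonneg_right hA (sq_nonneg σ)
      have : 0 ≤ q * σ ^ 2 := by positivity
      linarith
  rw [rotDistSq]
  refine (Finset.sum_le_sum fun i _ => hterm i).trans ?_
  rw [← Finset.mul_sum]
  refine (mul_le_mul_of_nonneg_left (sum_add_one_le_rankSum r) (by positivity)).trans_eq ?_
  rw [hq]
  field_simp

theorem factorDist_eq_sqrt {w : ℝ} {U V : Factors d r}
    {R : (k : Fin (N + 1)) → Matrix (Fin (r k)) (Fin (r k)) ℝ} (hR : IsBestRotation w U V R) :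
    factorDist w U V = Real.sqrt (rotDistSq w U V R) := by
  rw [factorDist]
  congr 1
  exact IsLeast.csInf_eq ⟨⟨R, hR.1, rfl⟩, by rintro _ ⟨R', hR', rfl⟩; exact hR.2 hR'⟩

theorem ttRank_eq_of_norm_sub_lt (h0 : r 0 = 1) (hN : r (Fin.last N) = 1)
    (s₀ : (i : Fin N) → Fin (d i)) (U : Factors d r) {V : Factors d r} (hV : LeftOrthogonal V)
    (k : Bond N) (hrank : ttRank (ttTensor h0 hN V) k = r k.1)
    (h : ‖ttTensor h0 hN U - ttTensor h0 hN V‖ < sigmaMin (ttTensor h0 hN V)) :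
    ttRank (ttTensor h0 hN U) k = r k.1 := by
  have hVc := cut_ttTensor h0 hN s₀ V k.1
  refine le_antisymm (ttRank_le_of_eq_mul (cut_ttTensor h0 hN s₀ U k.1)) ?_
  have h2 := sigmaMin_le_sv (ttTensor h0 hN V) k
  rw [sv, ttRank, unfolding_eq_cut, hVc] at h2
  have h3 := rank_le_of_frobNorm_sub_lt (leftMat_isometry h0 s₀ hV k.1 k.2.2)
    (Q := rightMat hN s₀ V k.1) (by rw [← hVc, Fintype.card_fin]; exact hrank)
    (cut (ttTensor h0 hN U) k.1) (by rw [← hVc, ← cut_sub, frobNorm_cut, hVc]; exact h.trans_le h2)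
  rwa [Fintype.card_fin] at h3

end Distance

/-! ### Scalar inequalities: subgradients of the absolute value and the choice of constants. -/

section Subgradient

/-- The subgradient inequality of `|·|` at the residual `z`, compared with the residual `-s` of the
ground truth. -/
theorem abs_sub_abs_le_sign_mul (z s : ℝ) : |z| - |s| ≤ Real.sign z * (z + s) := by
  rcases lt_trichotomy z 0 with h | rfl | h
  · rw [Real.sign_of_neg h, abs_of_neg h]
    linarith [le_abs_self s]
  · simp
  · rw [Real.sign_of_pos h, abs_of_pos h]
    linarith [neg_abs_le s]

theorem abs_sign_le_one (z : ℝ) : |Real.sign z| ≤ 1 := by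
  rcases Real.sign_apply_eq z with h | h | h <;> simp [h]

/-- Apart from `τ² / 144`, the squared radius is a product of ratios that are at most one. -/
theorem norm_ball_bound {N : ℕ} (hN2 : 2 ≤ N) {c K τ σ S e : ℝ} (hc : 0 ≤ c) (hK : 0 < K)
    (hcK : c ≤ K) (hτ : 0 < τ) (hτσ : τ ≤ σ) (hS : 1 ≤ S)
    (he : e ^ 2 ≤ τ ^ 4 * c ^ 2 /
      (144 * (2 * (N : ℝ) ^ 2 - 2 * N + 1) * S ^ 2 * K ^ 2 * σ ^ 2)) : e ≤ τ / 12 := by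
  have hN : (2 : ℝ) ≤ N := by exact_mod_cast hN2
  have hσ : 0 < σ := hτ.trans_le hτσ
  have hM : 1 ≤ 2 * (N : ℝ) ^ 2 - 2 * N + 1 := by nlinarith
  refine le_of_sq_le_sq (he.trans ?_) (by positivity)
  rw [div_le_iff₀ (by positivity)]
  have h1 : τ ^ 2 * c ^ 2 ≤ σ ^ 2 * K ^ 2 := by gcongr
  have h2 : 1 ≤ (2 * (N : ℝ) ^ 2 - 2 * N + 1) * S ^ 2 :=
    one_le_mul_of_one_le_of_one_le hM (one_le_pow₀ hS)
  calc τ ^ 4 * c ^ 2 = τ ^ 2 * (1 * (τ ^ 2 * c ^ 2)) := by ring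
    _ ≤ τ ^ 2 * (((2 * (N : ℝ) ^ 2 - 2 * N + 1) * S ^ 2) * (σ ^ 2 * K ^ 2)) := by gcongr
    _ = _ := by ring

theorem regularity_bound {N : ℕ} (hN2 : 2 ≤ N) {c K τ σ S e D z : ℝ} (hc : 0 ≤ c) (hK : 0 < K)
    (hτ : 0 < τ) (hσ : 0 < σ) (hS : 1 ≤ S) (he0 : 0 ≤ e) (hD0 : 0 ≤ D)
    (he : e ^ 2 ≤ τ ^ 4 * c ^ 2 /
      (144 * (2 * (N : ℝ) ^ 2 - 2 * N + 1) * S ^ 2 * K ^ 2 * σ ^ 2))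
    (hD : D ^ 2 ≤ 8 * S * (σ / τ) ^ 2 * e ^ 2) (hz : z ≤ 3 * N / (4 * σ) * D ^ 2) :
    c / (4 * Real.sqrt (2 * S) * (σ / τ)) * D ≤ c * e - K * z := by
  have hN : (2 : ℝ) ≤ N := by exact_mod_cast hN2
  have hM : (N : ℝ) ^ 2 ≤ 2 * (N : ℝ) ^ 2 - 2 * N + 1 := by nlinarith [sq_nonneg ((N : ℝ) - 1)]
  have hM0 : 0 < 2 * (N : ℝ) ^ 2 - 2 * N + 1 := by nlinarith
  set M := 2 * (N : ℝ) ^ 2 - 2 * N + 1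
  set q := Real.sqrt (2 * S) with hq
  have hq2 : q ^ 2 = 2 * S := Real.sq_sqrt (by positivity)
  have hq0 : 0 < q := Real.sqrt_pos.mpr (by positivity)
  have h1 : D ≤ 2 * q * (σ / τ) * e := by
    refine le_of_sq_le_sq (hD.trans_eq ?_) (by positivity)
    simp only [mul_pow, hq2]
    ring
  have h2 : 2 * (c / (4 * q * (σ / τ)) * D) ≤ c * e := by
    calc 2 * (c / (4 * q * (σ / τ)) * D)
        ≤ 2 * (c / (4 * q * (σ / τ)) * (2 * q * (σ / τ) * e)) := by gcongr
      _ = c * e := by field_simp; ring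
  -- The radius is tuned to this: `18 * 8 = 144`, and `N² ≤ 2N² - 2N + 1` because the gap is `(N -
  -- 1)²`.
  have h3 : 3 * K * N * q * D ≤ c * τ := by
    refine le_of_sq_le_sq ?_ (by positivity)
    calc (3 * K * N * q * D) ^ 2 = 18 * K ^ 2 * S * N ^ 2 * D ^ 2 := by
          simp only [mul_pow, hq2]; ring
      _ ≤ 18 * K ^ 2 * S * M * (8 * S * (σ / τ) ^ 2 *
          (τ ^ 4 * c ^ 2 / (144 * M * S ^ 2 * K ^ 2 * σ ^ 2))) := by
          gcongr
          exact hD.trans (by gcongr)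
      _ = (c * τ) ^ 2 := by field_simp; ring
  have h4 : K * z ≤ c / (4 * q * (σ / τ)) * D := by
    calc K * z ≤ K * (3 * N / (4 * σ) * D ^ 2) := by gcongr
      _ = (3 * K * N * q * D) * D / (4 * q * σ) := by field_simp
      _ ≤ (c * τ) * D / (4 * q * σ) := by gcongr
      _ = _ := by field_simp
  linarith

end Subgradient

/-! ### From sharpness and the RIP to a lower bound on the sign sum. -/

section Recovery

variable {N m : ℕ} {d : Fin N → ℕ} {r : Fin (N + 1) → ℕ}

/-- The subgradient inequality of the `ℓ₁` loss, with an error `Z` in the direction. -/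
theorem sign_sum_lower_bound {A : Fin m → Tensor d} {X Xstar Z : Tensor d} {s y : Fin m → ℝ}
    (hy : ∀ k, y k = inner ℝ (A k) Xstar + s k) {c K : ℝ}
    (hc : c * ‖X - Xstar‖ ≤ 1 / (m : ℝ) * ∑ k, |inner ℝ (A k) (X - Xstar) - s k| -
      1 / (m : ℝ) * ∑ k, |s k|)
    (hZ : 1 / (m : ℝ) * ∑ k, |inner ℝ (A k) Z| ≤ K * ‖Z‖) :
    c * ‖X - Xstar‖ - K * ‖Z‖ ≤
      1 / (m : ℝ) * ∑ k, Real.sign (inner ℝ (A k) X - y k) * inner ℝ (A k) (X - Xstar + Z) := by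
  have hterm : ∀ k, |inner ℝ (A k) (X - Xstar) - s k| - |s k| - |inner ℝ (A k) Z| ≤
      Real.sign (inner ℝ (A k) X - y k) * inner ℝ (A k) (X - Xstar + Z) := by
    intro k
    have hz : inner ℝ (A k) X - y k = inner ℝ (A k) (X - Xstar) - s k := by
      rw [hy, inner_sub_right]
      ring
    rw [hz, inner_add_right, mul_add]
    have h1 := abs_sub_abs_le_sign_mul (inner ℝ (A k) (X - Xstar) - s k) (s k)
    rw [sub_add_cancel] at h1
    have h2 : |Real.sign (inner ℝ (A k) (X - Xstar) - s k) * inner ℝ (A k) Z| ≤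
        |inner ℝ (A k) Z| := by
      rw [abs_mul]
      exact mul_le_of_le_one_left (abs_nonneg _) (abs_sign_le_one _)
    linarith [neg_abs_le (Real.sign (inner ℝ (A k) (X - Xstar) - s k) * inner ℝ (A k) Z)]
  have hsum := mul_le_mul_of_nonneg_left
    (Finset.sum_le_sum fun k (_ : k ∈ Finset.univ) => hterm k)
    (show (0 : ℝ) ≤ 1 / (m : ℝ) by positivity)
  simp only [Finset.sum_sub_distrib, mul_sub] at hsum
  linarith

theorem le_rMax (r : Fin (N + 1) → ℕ) (k : Bond N) : r k.1 ≤ rMax r :=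
  Finset.le_sup (f := fun k : Bond N => r k.1) (Finset.mem_univ k)

theorem one_le_rankSum (r : Fin (N + 1) → ℕ) : 1 ≤ rankSum r := by
  have h : 0 ≤ ∑ k ∈ Finset.univ.filter (fun k : Fin (N + 1) => 2 ≤ (k : ℕ) ∧ (k : ℕ) < N),
      (r k : ℝ) := Finset.sum_nonneg fun _ _ => Nat.cast_nonneg _
  have : (0 : ℝ) ≤ N := Nat.cast_nonneg _
  rw [rankSum]
  linarith

theorem ne_zero_of_one_le_ttRank {X : Tensor d} {k : Bond N} (h : 1 ≤ ttRank X k) : X ≠ 0 := by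
  rintro rfl
  have : unfolding (0 : Tensor d) k = 0 := rfl
  rw [ttRank, this, rank_zero] at h
  omega

/-- At a nonzero tensor the lower RIP constant cannot exceed the upper one. -/
theorem L1L2RIP.nonneg {A : Fin m → Tensor d} {ρ : ℕ} {δ : ℝ} (h : L1L2RIP A ρ δ) {X : Tensor d}
    (hX : ∀ k, ttRank X k ≤ ρ) (h0 : X ≠ 0) : 0 ≤ δ := by
  have h1 := (h X hX).1.trans (h X hX).2
  have h2 := le_of_mul_le_mul_right h1 (norm_pos_iff.mpr h0)
  linarith

theorem outlierFraction_nonneg (s : Fin m → ℝ) : 0 ≤ outlierFraction s := by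
  unfold outlierFraction
  positivity

end Recovery

end TTRecovery

end

/-! ### The regularity inequality. -/

theorem mainTheorem6 {N m : ℕ} (hN2 : 2 ≤ N) (hm : 0 < m) (d : Fin N → ℕ)
    -- the sizes `r_0, …, r_N` of the factors, with `r_0 = r_N = 1`
    (r : Fin (N + 1) → ℕ) (h0 : r 0 = 1) (hN : r (Fin.last N) = 1) (hr : ∀ k, 1 ≤ r k)
    -- the ground truth, with left-orthogonal factors `V` and TT ranks `r_1, …, r_{N-1}`
    (V : TTRecovery.Factors d r) (hV : TTRecovery.LeftOrthogonal V)
    (Xstar : TTRecovery.Tensor d) (hXstar : Xstar = TTRecovery.ttTensor h0 hN V)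
    (hrank : ∀ k, TTRecovery.ttRank Xstar k = r k.1)
    -- the measurements `y = A(Xstar) + s` and the fraction `p` of outliers
    (A : Fin m → TTRecovery.Tensor d) (s y : Fin m → ℝ)
    (hy : ∀ k, y k = inner ℝ (A k) Xstar + s k)
    (p : ℝ) (hp : p = TTRecovery.outlierFraction s)
    (δ : ℝ) (hδ : δ ≤ (1 - 2 * p) * Real.sqrt (2 / Real.pi))
    (hRIP : TTRecovery.L1L2RIP A ((N + 1) * TTRecovery.rMax r) δ)
    (hsharp : TTRecovery.Sharpness A Xstar s δ)
    (b : ℝ)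
    (hb : b = TTRecovery.sigmaMin Xstar ^ 4 * ((1 - 2 * p) * Real.sqrt (2 / Real.pi) - δ) ^ 2 /
      (144 * (2 * (N : ℝ) ^ 2 - 2 * N + 1) * TTRecovery.rankSum r ^ 2 *
        (Real.sqrt (2 / Real.pi) + δ) ^ 2 * TTRecovery.sigmaMax Xstar ^ 2))
    -- any TT format tensor in the ball, with left-orthogonal factors `U`
    (U : TTRecovery.Factors d r) (hU : TTRecovery.LeftOrthogonal U)
    (hball : ‖TTRecovery.ttTensor h0 hN U - Xstar‖ ^ 2 ≤ b)
    -- any optimal rotations for the distance of `U` and `V`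
    (R : (k : Fin (N + 1)) → Matrix (Fin (r k)) (Fin (r k)) ℝ)
    (hR : TTRecovery.IsBestRotation (TTRecovery.sigmaMax Xstar) U V R) :
    ((1 - 2 * p) * Real.sqrt (2 / Real.pi) - δ) /
        (4 * Real.sqrt (2 * TTRecovery.rankSum r) * TTRecovery.kappa Xstar) *
        TTRecovery.factorDist (TTRecovery.sigmaMax Xstar) U V ≤
      ∑ i : Fin N, TTRecovery.frobInner
        (TTRecovery.leftUnfold (U i) - TTRecovery.leftUnfold (TTRecovery.rotate R V i))
        (TTRecovery.riemSubgrad h0 hN A y U i) := by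
  subst hXstar hp hb
  set X := TTRecovery.ttTensor h0 hN U with hX
  set Xs := TTRecovery.ttTensor h0 hN V with hXs
  obtain ⟨k₀⟩ := TTRecovery.nonempty_bond hN2
  have hXs0 : Xs ≠ 0 := TTRecovery.ne_zero_of_one_le_ttRank (k := k₀) (by rw [hrank]; exact hr _)
  -- A nonzero tensor has an index, which serves as the base point of the partial products.
  obtain ⟨s₀, -⟩ : ∃ s₀, Xs s₀ ≠ 0 := by
    by_contra! h
    exact hXs0 (PiLp.ext h)
  have hδ0 : 0 ≤ δ := hRIP.nonneg (X := Xs) (fun k => by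
    rw [hrank]
    exact (TTRecovery.le_rMax r k).trans (Nat.le_mul_of_pos_left _ (by omega))) hXs0
  have hτ : 0 < TTRecovery.sigmaMin Xs :=
    TTRecovery.sigmaMin_pos hN2 Xs fun k => by rw [hrank]; exact hr _
  have hτσ := TTRecovery.sigmaMin_le_sigmaMax hN2 Xs
  have hS := TTRecovery.one_le_rankSum r
  have ha : 0 < Real.sqrt (2 / Real.pi) := Real.sqrt_pos.mpr (by positivity)
  have hp0 := mul_nonneg (TTRecovery.outlierFraction_nonneg s) ha.le
  set a := Real.sqrt (2 / Real.pi)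
  set c := (1 - 2 * TTRecovery.outlierFraction s) * a - δ with hc
  have hc0 : 0 ≤ c := sub_nonneg.mpr hδ
  have hcK : c ≤ a + δ := by linarith
  have hK : 0 < a + δ := by linarith
  have he := TTRecovery.norm_ball_bound hN2 hc0 hK hcK hτ hτσ hS hball
  have hsh := hsharp X fun k => by
    rw [hrank]
    exact TTRecovery.ttRank_eq_of_norm_sub_lt h0 hN s₀ U hV k (hrank k) (by linarith)
  have hW := TTRecovery.leftOrthogonal_rotate hR.1 hV
  have hWt : TTRecovery.ttTensor h0 hN (TTRecovery.rotate R V) = Xs :=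
    TTRecovery.ttTensor_rotate h0 hN hR.1 V
  set W := TTRecovery.rotate R V
  set Z := ∑ i, TTRecovery.sandwich h0 hN U i (TTRecovery.tangentDiff U W i) U - (X - Xs) with hZ
  have hZr : ∀ k, TTRecovery.ttRank Z k ≤ (N + 1) * TTRecovery.rMax r := fun k => by
    rw [hZ, ← hWt]
    exact (TTRecovery.rank_cut_linearization_le h0 hN s₀ U W _ k.1).trans
      -- `3 ≤ N + 1` because `N ≥ 2`.
      (Nat.mul_le_mul (by omega) (TTRecovery.le_rMax r k))
  have hZn : ‖Z‖ ≤ 3 * N / (4 * TTRecovery.sigmaMax Xs) *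
      TTRecovery.rotDistSq (TTRecovery.sigmaMax Xs) U V R := by
    rw [hZ, ← hWt]
    refine TTRecovery.ttTensor_linearization_le h0 hN s₀ hU hW
      (by rw [hWt]; linarith) fun k => ?_
    rw [hWt]
    have h1 : TTRecovery.cut X k.1 = TTRecovery.cut Xs k.1 + TTRecovery.cut (X - Xs) k.1 := by
      rw [TTRecovery.cut_sub]
      abel
    rw [← hX, h1]
    refine ((TTRecovery.opLe_cut Xs k).add (TTRecovery.opLe_frobNorm _)).mono ?_
    rw [TTRecovery.frobNorm_cut]
    linarith
  obtain ⟨R', hR', hdist⟩ := TTRecovery.exists_rotations_rotDistSq_le hN2 h0 hN s₀ hU hV hrank hτ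
  have hD0 : 0 ≤ TTRecovery.rotDistSq (TTRecovery.sigmaMax Xs) U V R :=
    Finset.sum_nonneg fun i _ => mul_nonneg (by split_ifs <;> positivity)
      (by rw [← TTRecovery.frobNorm_sq]; positivity)
  have hD : TTRecovery.factorDist (TTRecovery.sigmaMax Xs) U V ^ 2 =
      TTRecovery.rotDistSq (TTRecovery.sigmaMax Xs) U V R := by
    rw [TTRecovery.factorDist_eq_sqrt hR, Real.sq_sqrt hD0]
  rw [TTRecovery.sum_frobInner_riemSubgrad h0 hN A y U W]
  have hlow := TTRecovery.sign_sum_lower_bound (X := X) (Z := Z) hy hsh (hRIP Z hZr).2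
  rw [hZ, add_sub_cancel] at hlow
  refine le_trans ?_ hlow
  refine TTRecovery.regularity_bound hN2 hc0 hK hτ (hτ.trans_le hτσ) hS (norm_nonneg _)
    (Real.sqrt_nonneg _) hball ?_ ?_
  · rw [hD]
    -- The aligned rotations `R'` need not be optimal; they only bound the minimum attained at `R`.
    exact (hR.2 hR').trans hdist
  · rw [hD]
    exact hZn
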